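/- **Theorem 3.1 (Concentration inequalities).** Let $\mathcal X$ be a Polish space and let $(\Omega,\mathcal F,\mathcal F_t,X_t,P^x)$, $x\in\mathcal X$, be a time-homogeneous $\mathcal X$-valued càdlàg Markov family ($P^x(X_0=x)=1$), with invariant ergodic probability measure $\mu^*$. Write $P^\mu=\int P^x\,d\mu(x)$, $\mu^*[f]=\int f\,d\mu^*$, let $\langle\cdot,\cdot\rangle$ and $\|\cdot\|$ be the scalar product and norm of the real Hilbert space $L^2(\mu^*)$, and let $(A,D(A))$ be the generator of the semigroup $\mathcal P_tg(x)=E^x[g(X_t)]$ on $L^2(\mu^*)$. Let $\langle\cdot,\cdot\rangle_\#$ be an inner product on $L^2(\mu^*)$, with induced norm $\|\cdot\|_\#$, such that 1. there are $0<c\le C<\infty$ with $c\|g\|\le\|g\|_\#\le C\|g\|$ for all $g\in L^2(\mu^*)$; 2. $\langle g,1\rangle_\#=\langle g,1\rangle$ for all $g\in L^2(\mu^*)$; 3. there is $\alpha>0$ with $\|g\|_\#^2\le\alpha\langle -Ag,g\rangle_\#$ for all $g\in D(A)$ with $\mu^*[g]=0$. Let $f:\mathcal X\to\mathbb R$ be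 bounded and measurable, $\widehat f=f-\mu^*[f]$, and let $M_{\pm\widehat f}$ be the operator of multiplication by $\pm\widehat f$ on $L^2(\mu^*)$. Then $M_{\pm\widehat f}$ has an adjoint $M_{\pm\widehat f}^\dagger$, a bounded operator, with respect to $\langle\cdot,\cdot\rangle_\#$. Put $$v_\pm=2\alpha\left\|\tfrac12\bigl(M_{\pm\widehat f}+M_{\pm\widehat f}^\dagger\bigr)1\right\|_\#^2,\qquad b_\pm=\alpha\max\Bigl\{0,\sup_{\|g\|_\#=1}\langle M_{\pm\widehat f}\,g,g\rangle_\#\Bigr\}.$$ For every $T>0$, every $r\ge0$ and every probability measure $\mu\ll\mu^*$, $$P^\mu\left(\pm\left[\frac1T\int_0^Tf(X_t)\,dt-\mu^*[f]\right]\ge r\right)\le c^{-1}\left\|\frac{d\mu}{d\mu^*}\right\|e^{-T\Psi^*_{v_\pm,b_\pm}(r)},$$ where, with $1/b=\infty$ if $b=0$ and with values in $[0,\infty]$, $$\Psi^*_{v,b}(r)=\sup_{0\le\lambda<1/b}\left\{\lambda r-\frac{\lambda^2v}{2(1-\lambda b)}\right\}.$$ Moreover, if $v_\pm>0$, then with $v=v_\pm$,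 $b=b_\pm$, $$\Psi^*_{v,b}(r)=\frac{2r^2}{v\left(1+\sqrt{1+\frac{2br}{v}}\right)^2}.$$ (If $\|d\mu/d\mu^*\|=\infty$ the right-hand side of the inequality is read with the convention $\infty\cdot0=0$.) -/

import Mathlib

open MeasureTheory ProbabilityTheory Filter Topology Set
open scoped ENNReal NNReal

noncomputable section

/-- A time-homogeneous càdlàg Markov family `(Ω, F, F_t, X_t, P^x)`, `x ∈ E`: the process `X` is
adapted to `F_t`, every path is right-continuous with left limits, `P^x` (measurable in `x`, as
`P` is a kernel) is a probability measure under which `X` starts from `x`, and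
`P^x(X_{s+t} ∈ B | F_s) = P^{X_s}(X_t ∈ B)` holds `P^x`-almost surely. -/
structure IsCadlagMarkovFamily {E Ω : Type*} [TopologicalSpace E] [MeasurableSpace E]
    {mΩ : MeasurableSpace Ω} (ℱ : Filtration ℝ≥0 mΩ) (X : ℝ≥0 → Ω → E) (P : Kernel E Ω) :
    Prop where
  isMarkovKernel : IsMarkovKernel P
  adapted : ∀ t, Measurable[ℱ t] (X t)
  right_continuous : ∀ ω t, ContinuousWithinAt (fun s => X s ω) (Ici t) t
  left_limits : ∀ ω t, ∃ l, Tendsto (fun s => X s ω) (𝓝[<] t) (𝓝 l)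
  start : ∀ x, (P x).map (X 0) = Measure.dirac x
  markov : ∀ (x : E) (s t : ℝ≥0) (B : Set E), MeasurableSet B →
    (P x)⟦X (s + t) ⁻¹' B | ℱ s⟧ =ᵐ[P x] fun ω => (P (X s ω)).real (X t ⁻¹' B)

/-- The Markov semigroup `(𝒫_t g)(x) = E^x[g(X_t)]`. -/
def markovSemigroup {E Ω : Type*} [MeasurableSpace E] [MeasurableSpace Ω]
    (X : ℝ≥0 → Ω → E) (P : Kernel E Ω) (t : ℝ≥0) (g : E → ℝ) (x : E) : ℝ :=
  ∫ ω, g (X t ω) ∂(P x)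

/-- `μ` is invariant: if `X_0 ∼ μ` then `X_t ∼ μ` for all `t`. Here `μ.bind P` is
`P^μ = ∫ P^x dμ(x)`. -/
def IsInvariantLaw {E Ω : Type*} [MeasurableSpace E] [MeasurableSpace Ω]
    (X : ℝ≥0 → Ω → E) (P : Kernel E Ω) (μ : Measure E) : Prop :=
  ∀ t, (μ.bind P).map (X t) = μ

/-- `μ` is ergodic: a set whose indicator is fixed by the semigroup, up to `μ`-null sets, has
measure zero or one. -/
def IsErgodicLaw {E Ω : Type*} [MeasurableSpace E] [MeasurableSpace Ω]
    (X : ℝ≥0 → Ω → E) (P : Kernel E Ω) (μ : Measure E) : Prop :=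
  ∀ B : Set E, MeasurableSet B →
    (∀ t, markovSemigroup X P t (B.indicator fun _ => 1) =ᵐ[μ] B.indicator fun _ => 1) →
    μ B = 0 ∨ μ B = 1

/-- The graph of the generator `(A, D(A))` of the Markov semigroup on `L²(μ)`: `g ∈ D(A)` and
`A g = h`, that is, `(𝒫_t g - g) / t → h` in `L²(μ)` as `t ↓ 0`. -/
def GeneratorGraph {E Ω : Type*} [MeasurableSpace E] [MeasurableSpace Ω]
    (X : ℝ≥0 → Ω → E) (P : Kernel E Ω) (μ : Measure E) (g h : Lp ℝ 2 μ) : Prop :=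
  Tendsto
    (fun t : ℝ≥0 =>
      eLpNorm (fun x => (t : ℝ)⁻¹ * (markovSemigroup X P t g x - g x) - h x) 2 μ)
    (𝓝[>] 0) (𝓝 0)

/-- The norm induced by an inner product. -/
def sharpNorm {H : Type*} [AddCommGroup H] [Module ℝ H] (ip : InnerProductSpace.Core ℝ H)
    (g : H) : ℝ :=
  √(ip.inner g g)

/-- The operator of multiplication by an essentially bounded function on `L²(μ)`. -/
def mulOp {E : Type*} [MeasurableSpace E] {μ : Measure E} {V : E → ℝ} (hV : MemLp V ∞ μ) :
    Lp ℝ 2 μ →L[ℝ] Lp ℝ 2 μ :=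
  (ContinuousLinearMap.mul ℝ ℝ).holderL μ ∞ 2 2 (hV.toLp V)

/-- For bounded measurable `f`, the function `σ (f - μ[f])` is essentially bounded. -/
theorem memLp_centered {E : Type*} [MeasurableSpace E] (μ : Measure E)
    {f : E → ℝ} (hf : Measurable f) (hb : ∃ K, ∀ x, |f x| ≤ K) (σ : ℝ) :
    MemLp (fun x => σ * (f x - ∫ y, f y ∂μ)) ∞ μ := by
  obtain ⟨K, hK⟩ := hb
  refine memLp_top_of_bound (by fun_prop) (|σ| * (K + |∫ y, f y ∂μ|)) (ae_of_all _ fun x => ?_)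
  rw [Real.norm_eq_abs, abs_mul]
  have h1 := abs_sub (f x) (∫ y, f y ∂μ)
  have h2 := hK x
  gcongr
  linarith

/-- `Ψ_{v,b}(l) = l² v / (2 (1 - l b))`, used for `0 ≤ l < 1/b`. -/
def bernsteinPsi (v b l : ℝ) : ℝ := l ^ 2 * v / (2 * (1 - l * b))

/-- The one-sided Legendre transform `Ψ*_{v,b}(r) = sup {l r - Ψ_{v,b}(l) : 0 ≤ l < 1/b}` for
`b ≥ 0`, with `1/b = ∞` if `b = 0`. It is extended-real valued since it equals `∞` if
`v = b = 0 < r`. -/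
def bernsteinPsiStar (v b r : ℝ) : EReal :=
  ⨆ l ∈ {l : ℝ | 0 ≤ l ∧ l * b < 1}, ((l * r - bernsteinPsi v b l : ℝ) : EReal)

/-- `v = 2 α ‖(M 1 + M† 1) / 2‖_#²`, where `one` is the constant function `1`. -/
def sharpV {H : Type*} [AddCommGroup H] [Module ℝ H] (ip : InnerProductSpace.Core ℝ H)
    (α : ℝ) (M Mdag : H → H) (one : H) : ℝ :=
  2 * α * sharpNorm ip ((1 / 2 : ℝ) • (M one + Mdag one)) ^ 2

/-- `b = α max {0, sup {⟨M g, g⟩_# : ‖g‖_# = 1}}`. -/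
def sharpB {H : Type*} [AddCommGroup H] [Module ℝ H] (ip : InnerProductSpace.Core ℝ H)
    (α : ℝ) (M : H → H) : ℝ :=
  α * max 0 (sSup {a : ℝ | ∃ g : H, sharpNorm ip g = 1 ∧ a = ip.inner (M g) g})

end

/-! For `V = ±(f - μ*[f])` and `l ≥ 0` let `u_t(x) = E^x[exp(l ∫_0^t V(X_s) ds)]`. Chernoff's bound,
and Cauchy–Schwarz against `dμ/dμ*`, reduce the tail estimate to `‖u_T‖ ≤ c⁻¹ exp(T Ψ(l))` with `Ψ =
Ψ_{v,b}`; taking the supremum over `l` produces the Legendre transform.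

Formally `u' = (A + l V) u`, so half the derivative of `‖u‖_#²` is `⟨(A + l M) u, u⟩_#`, and a bound
of this form by `Ψ(l) ‖u‖_#²` integrates by Gronwall (`core_inner_le_exp_of_deriv_le`). For the form
bound (`core_inner_energy_le`) write `u = m 1 + h` with `h ⊥ 1`. The Poincaré inequality gives `⟨A
h, h⟩_# ≤ -‖h‖_#² / α`, the constant `b` absorbs `l ⟨M h, h⟩_#`, and the `m² ` term vanishes because
`V` is centred. The cross term pairs `h` with `(M 1 + M† 1) / 2`, whence `v`; completing the square
finishes.

The equation `u' = (A + l V) u` is proved in `L²` from the paths, without perturbation theory of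
semigroups. The right derivative of `u_t` is `E^x[exp(l ∫_0^t V) l V(X_t)]`. By the Markov property
`𝒫_h u_t = E^x[exp(l ∫_h^{h+t} V)]`, whose difference quotient at `h = 0` tends to `u_t' - l V u_t`;
thus `u_t ∈ D(A)`. Both limits rest on the mean-square right-continuity of `V(X_s)` under the
stationary law. -/

/-! ### Joint measurability of paths, and the Markov property for bounded functions. -/

/-- A process with measurable marginals and right-continuous paths is jointly measurable. -/
theorem measurable_uncurry_of_continuousWithinAt_Ici {E Ω : Type*} [TopologicalSpace E]
    [TopologicalSpace.PseudoMetrizableSpace E] [MeasurableSpace E] [BorelSpace E]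
    [MeasurableSpace Ω] {X : ℝ≥0 → Ω → E} (hm : ∀ t, Measurable (X t))
    (hr : ∀ ω t, ContinuousWithinAt (fun s => X s ω) (Ici t) t) :
    Measurable (fun p : ℝ≥0 × Ω => X p.1 p.2) := by
  -- Times are rounded up to the grid of mesh `1 / (n + 1)`, so right-continuity applies and only
  -- countably many marginals occur at each `n`.
  let d : ℕ → ℝ≥0 → ℝ≥0 := fun n t => (⌊t * (n + 1)⌋₊ + 1) / (n + 1)
  have hd_le : ∀ n t, t ≤ d n t := fun n t => by
    simp only [d]
    rw [le_div_iff₀ (by positivity)]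
    exact (Nat.lt_floor_add_one _).le
  have hd_ub : ∀ n t, d n t ≤ t + 1 / ((n : ℝ≥0) + 1) := fun n t => by
    simp only [d]
    rw [add_div]
    gcongr
    rw [div_le_iff₀ (by positivity)]
    exact Nat.floor_le (by positivity)
  have hd : ∀ t, Tendsto (fun n => d n t) atTop (𝓝[≥] t) := fun t => by
    refine tendsto_nhdsWithin_iff.2 ⟨?_, Eventually.of_forall fun n => hd_le n t⟩
    refine tendsto_of_tendsto_of_tendsto_of_le_of_le tendsto_const_nhds ?_
      (fun n => hd_le n t) (fun n => hd_ub n t)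
    simpa using tendsto_const_nhds.add (tendsto_one_div_add_atTop_nhds_zero_nat (𝕜 := ℝ≥0))
  refine measurable_of_tendsto_metrizable (f := fun n p => X (d n p.1) p.2) (fun n => ?_) ?_
  · have h1 : Measurable (fun q : ℕ × Ω => X ((q.1 + 1) / ((n : ℝ≥0) + 1)) q.2) :=
      measurable_from_prod_countable_right fun k =>
        hm (((k : ℝ≥0) + 1) / ((n : ℝ≥0) + 1))
    have h2 : Measurable (fun p : ℝ≥0 × Ω => (⌊p.1 * ((n : ℝ≥0) + 1)⌋₊, p.2)) := by
      refine Measurable.prodMk (Nat.measurable_floor.comp (by fun_prop)) measurable_snd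
    have h3 := h1.comp h2
    simp only [Function.comp_def] at h3
    simpa only [d] using h3
  · exact tendsto_pi_nhds.2 fun p => (hr p.2 p.1).tendsto.comp (hd p.1)

theorem integral_bind_kernel {α β : Type*} [MeasurableSpace α] [MeasurableSpace β]
    (μ : Measure α) (κ : Kernel α β) {f : β → ℝ} (hf : Integrable f (μ.bind κ)) :
    ∫ y, f y ∂(μ.bind κ) = ∫ x, ∫ y, f y ∂(κ x) ∂μ := by
  rw [Measure.comp_eq_comp_const_apply] at hf ⊢
  rw [Kernel.integral_comp hf, Kernel.const_apply]

namespace IsCadlagMarkovFamily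

variable {E Ω : Type*} [TopologicalSpace E] [MeasurableSpace E] {mΩ : MeasurableSpace Ω}
  {ℱ : Filtration ℝ≥0 mΩ} {X : ℝ≥0 → Ω → E} {P : Kernel E Ω}

theorem measurable (hX : IsCadlagMarkovFamily ℱ X P) (t : ℝ≥0) : Measurable (X t) :=
  (hX.adapted t).mono (ℱ.le t) le_rfl

/-- Phrasing the Markov property as an equality of measures extends it at once from indicators to
integrals of bounded functions. -/
theorem map_restrict_eq_bind (hX : IsCadlagMarkovFamily ℱ X P) (x : E) (s t : ℝ≥0)
    {A : Set Ω} (hA : MeasurableSet[ℱ s] A) :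
    ((P x).restrict A).map (X (s + t)) =
      ((P x).restrict A).bind ((P.map (X t)).comap (X s) (hX.measurable s)) := by
  have := hX.isMarkovKernel
  have hA' := ℱ.le s A hA
  ext B hB
  have hm := hX.markov x s t B hB
  have hBm : MeasurableSet (X (s + t) ⁻¹' B) := hX.measurable _ hB
  have h1 : ∫ ω in A, (P (X s ω)).real (X t ⁻¹' B) ∂(P x) =
      ∫ ω in A, (X (s + t) ⁻¹' B).indicator (fun _ => (1 : ℝ)) ω ∂(P x) := by
    rw [← setIntegral_condExp (f := (X (s + t) ⁻¹' B).indicator fun _ => (1 : ℝ)) (ℱ.le s)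
      ((integrable_const 1).indicator hBm) hA]
    exact integral_congr_ae (ae_restrict_of_ae (hm.mono fun ω h => h.symm))
  rw [Measure.map_apply (hX.measurable _) hB, Measure.bind_apply hB (Kernel.aemeasurable _)]
  simp only [Kernel.comap_apply, Kernel.map_apply' _ (hX.measurable t) _ hB]
  have hmeas : Measurable fun ω => P (X s ω) (X t ⁻¹' B) :=
    (P.measurable_coe (hX.measurable t hB)).comp (hX.measurable s)
  rw [integral_indicator hBm, setIntegral_const, smul_eq_mul, mul_one] at h1
  have h2 := integral_toReal (μ := (P x).restrict A) hmeas.aemeasurable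
    (ae_of_all _ fun ω => measure_lt_top _ _)
  rw [← ENNReal.toReal_eq_toReal_iff' (measure_ne_top _ _), ← h2]
  · exact h1.symm
  · refine ne_of_lt (lt_of_le_of_lt (lintegral_mono (fun ω => prob_le_one)) ?_)
    simp

theorem measurable_markovSemigroup (hX : IsCadlagMarkovFamily ℱ X P) (t : ℝ≥0) {g : E → ℝ}
    (hg : Measurable g) : Measurable (markovSemigroup X P t g) :=
  ((hg.comp (hX.measurable t)).stronglyMeasurable.integral_kernel (κ := P)).measurable

theorem abs_markovSemigroup_le (hX : IsCadlagMarkovFamily ℱ X P) (t : ℝ≥0) {g : E → ℝ}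
    {K : ℝ} (hK : ∀ x, |g x| ≤ K) (x : E) : |markovSemigroup X P t g x| ≤ K := by
  have := hX.isMarkovKernel
  simpa [markovSemigroup] using norm_integral_le_of_norm_le_const (μ := P x) (f := fun ω => g (X t ω)) (C := K)
    (ae_of_all _ fun ω => hK (X t ω))

/-- The simple Markov property, tested against bounded functions. -/
theorem integral_mul_comp (hX : IsCadlagMarkovFamily ℱ X P) (x : E) (s t : ℝ≥0)
    {G : Ω → ℝ} (hG : Measurable[ℱ s] G) {K : ℝ} (hGK : ∀ ω, |G ω| ≤ K)
    {g : E → ℝ} (hg : Measurable g) {K' : ℝ} (hgK : ∀ x, |g x| ≤ K') :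
    ∫ ω, G ω * g (X (s + t) ω) ∂(P x) =
      ∫ ω, G ω * markovSemigroup X P t g (X s ω) ∂(P x) := by
  have := hX.isMarkovKernel
  have hg1 : Integrable (fun ω => g (X (s + t) ω)) (P x) :=
    Integrable.of_bound (hg.comp (hX.measurable _)).aestronglyMeasurable K'
      (ae_of_all _ fun ω => hgK _)
  have hsg := hX.measurable_markovSemigroup t hg
  have hg2 : Integrable (fun ω => markovSemigroup X P t g (X s ω)) (P x) :=
    Integrable.of_bound (hsg.comp (hX.measurable _)).aestronglyMeasurable K'
      (ae_of_all _ fun ω => hX.abs_markovSemigroup_le t hgK _)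
  have hce : (fun ω => markovSemigroup X P t g (X s ω)) =ᵐ[P x]
      (P x)[fun ω => g (X (s + t) ω) | ℱ s] := by
    refine ae_eq_condExp_of_forall_setIntegral_eq (ℱ.le s) hg1 (fun _ _ _ => hg2.integrableOn)
      (fun A hA _ => ?_) (hsg.comp (hX.adapted s)).stronglyMeasurable.aestronglyMeasurable
    have h1 := hX.map_restrict_eq_bind x s t hA
    rw [← integral_map (φ := X (s + t)) (hX.measurable _).aemeasurable
      hg.aestronglyMeasurable, h1, integral_bind_kernel]
    · refine integral_congr_ae (ae_of_all _ fun ω => ?_)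
      simp only [Kernel.comap_apply, Kernel.map_apply _ (hX.measurable t)]
      rw [integral_map (hX.measurable t).aemeasurable hg.aestronglyMeasurable]
      rfl
    · rw [← h1]
      exact Integrable.of_bound hg.aestronglyMeasurable K' (ae_of_all _ fun y => hgK y)
  have hGi : AEStronglyMeasurable G (P x) := (hG.mono (ℱ.le s) le_rfl).aestronglyMeasurable
  have h3 := condExp_stronglyMeasurable_mul_of_bound (μ := P x) (ℱ.le s) hG.stronglyMeasurable
    hg1 K (ae_of_all _ hGK)
  calc ∫ ω, G ω * g (X (s + t) ω) ∂(P x)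
      = ∫ ω, (P x)[G * (fun ω => g (X (s + t) ω)) | ℱ s] ω ∂(P x) :=
        (integral_condExp (ℱ.le s)).symm
    _ = _ := integral_congr_ae (by
        filter_upwards [h3, hce] with ω h4 h5
        rw [h4, Pi.mul_apply, ← h5])

end IsCadlagMarkovFamily

/-! ### Exponential functionals and mixed moments. -/

/-- The `n`-th power of an integral is an integral over the `n`-fold product, so Fubini exposes the
mixed moments. -/
theorem integral_pow_integral {Ω S : Type*} [MeasurableSpace Ω] [MeasurableSpace S]
    (ν : Measure Ω) [IsFiniteMeasure ν] (τ : Measure S) [IsFiniteMeasure τ]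
    {Y : S → Ω → ℝ} (hY : Measurable fun p : S × Ω => Y p.1 p.2) {K : ℝ}
    (hK : ∀ s ω, |Y s ω| ≤ K) (n : ℕ) :
    ∫ ω, (∫ s, Y s ω ∂τ) ^ n ∂ν =
      ∫ s : Fin n → S, ∫ ω, ∏ i, Y (s i) ω ∂ν ∂(Measure.pi fun _ => τ) := by
  have h1 : ∀ ω, (∫ s, Y s ω ∂τ) ^ n =
      ∫ s : Fin n → S, ∏ i, Y (s i) ω ∂(Measure.pi fun _ => τ) := fun ω => by
    rw [integral_fintype_prod_eq_pow (fun s => Y s ω), Fintype.card_fin]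
  simp_rw [h1]
  refine integral_integral_swap (Integrable.of_bound (C := K ^ n) ?_ (ae_of_all _ fun p => ?_))
  · refine Measurable.aestronglyMeasurable ?_
    refine Finset.measurable_prod _ fun i _ => ?_
    have h2 : Measurable fun p : Ω × (Fin n → S) => (p.2 i, p.1) := by fun_prop
    exact hY.comp h2
  · simp only [Function.uncurry, Real.norm_eq_abs, Finset.abs_prod]
    exact (Finset.prod_le_prod (fun _ _ => abs_nonneg _) (fun i _ => hK _ _)).trans (by simp)

theorem hasSum_integral_pow_div_factorial {Ω : Type*} [MeasurableSpace Ω]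
    (ν : Measure Ω) [IsFiniteMeasure ν] {Z : Ω → ℝ} (hZ : Measurable Z) {K : ℝ}
    (hK : ∀ ω, |Z ω| ≤ K) :
    HasSum (fun n : ℕ => (∫ ω, Z ω ^ n ∂ν) / n.factorial) (∫ ω, Real.exp (Z ω) ∂ν) := by
  have hb : ∀ (n : ℕ) ω, ‖Z ω ^ n / n.factorial‖ ≤ K ^ n / n.factorial := fun n ω => by
    rw [Real.norm_eq_abs, abs_div, abs_pow, Nat.abs_cast]
    gcongr
    exact hK ω
  have hi : ∀ n : ℕ, Integrable (fun ω => Z ω ^ n / n.factorial) ν := fun n =>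
    Integrable.of_bound ((hZ.pow_const n).div_const _).aestronglyMeasurable _
      (ae_of_all _ (hb n))
  have hs : Summable fun n : ℕ => ∫ ω, ‖Z ω ^ n / n.factorial‖ ∂ν := by
    refine Summable.of_nonneg_of_le (fun n => integral_nonneg fun ω => norm_nonneg _)
      (fun n => ?_) ((Real.summable_pow_div_factorial K).mul_left (ν.real univ))
    refine (integral_mono (hi n).norm (integrable_const _) (hb n)).trans ?_
    rw [integral_const, smul_eq_mul]
  have h := hasSum_integral_of_summable_integral_norm hi hs
  simp only [integral_div] at h
  have he : ∀ ω, Real.exp (Z ω) = ∑' n : ℕ, Z ω ^ n / n.factorial := fun ω => by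
    simpa only [Real.exp_eq_exp_ℝ] using congrFun (NormedSpace.exp_eq_tsum_div (𝔸 := ℝ)) (Z ω)
  simpa only [he] using h

/-- The law of `exp ∫ Y_s dτ(s)` for a bounded process `Y` is determined by the mixed moments. -/
theorem integral_exp_integral_eq_of_moments {Ω₁ Ω₂ S : Type*} [MeasurableSpace Ω₁]
    [MeasurableSpace Ω₂] [MeasurableSpace S] (ν₁ : Measure Ω₁) [IsFiniteMeasure ν₁]
    (ν₂ : Measure Ω₂) [IsFiniteMeasure ν₂] (τ : Measure S) [IsFiniteMeasure τ]
    {Y₁ : S → Ω₁ → ℝ} (hY₁ : Measurable fun p : S × Ω₁ => Y₁ p.1 p.2)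
    {Y₂ : S → Ω₂ → ℝ} (hY₂ : Measurable fun p : S × Ω₂ => Y₂ p.1 p.2) {K : ℝ}
    (hK₁ : ∀ s ω, |Y₁ s ω| ≤ K) (hK₂ : ∀ s ω, |Y₂ s ω| ≤ K)
    (hmom : ∀ (n : ℕ) (s : Fin n → S), ∫ ω, ∏ i, Y₁ (s i) ω ∂ν₁ = ∫ ω, ∏ i, Y₂ (s i) ω ∂ν₂) :
    ∫ ω, Real.exp (∫ s, Y₁ s ω ∂τ) ∂ν₁ = ∫ ω, Real.exp (∫ s, Y₂ s ω ∂τ) ∂ν₂ := by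
  have hm₁ : Measurable fun ω => ∫ s, Y₁ s ω ∂τ :=
    hY₁.stronglyMeasurable.integral_prod_left'.measurable
  have hm₂ : Measurable fun ω => ∫ s, Y₂ s ω ∂τ :=
    hY₂.stronglyMeasurable.integral_prod_left'.measurable
  have h₁ := hasSum_integral_pow_div_factorial ν₁ hm₁ (K := K * τ.real univ)
    fun ω => norm_integral_le_of_norm_le_const (f := fun s => Y₁ s ω)
      (ae_of_all _ fun s => hK₁ s ω)
  have h₂ := hasSum_integral_pow_div_factorial ν₂ hm₂ (K := K * τ.real univ)
    fun ω => norm_integral_le_of_norm_le_const (f := fun s => Y₂ s ω)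
      (ae_of_all _ fun s => hK₂ s ω)
  simp_rw [integral_pow_integral ν₁ τ hY₁ hK₁, hmom,
    ← integral_pow_integral ν₂ τ hY₂ hK₂] at h₁
  exact h₁.unique h₂

/-! ### Path integrals, Feynman–Kac functions and their Markov property. -/

/-- `∫_a^b V(X_s) ds` along the path `ω`. -/
noncomputable def pathIntegral {E Ω : Type*} (X : ℝ≥0 → Ω → E) (V : E → ℝ) (a b : ℝ) (ω : Ω) :
    ℝ :=
  ∫ s in a..b, V (X s.toNNReal ω)

/-- The Feynman–Kac function `E^x[exp ∫_0^t V(X_s) ds]`. -/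
noncomputable def feynmanKac {E Ω : Type*} [MeasurableSpace E] [MeasurableSpace Ω]
    (X : ℝ≥0 → Ω → E) (P : Kernel E Ω) (V : E → ℝ) (t : ℝ) (x : E) : ℝ :=
  ∫ ω, Real.exp (pathIntegral X V 0 t ω) ∂(P x)

theorem abs_pathIntegral_le {E Ω : Type*} {X : ℝ≥0 → Ω → E} {V : E → ℝ} {K : ℝ}
    (hK : ∀ x, |V x| ≤ K) {a b : ℝ} (hab : a ≤ b) (ω : Ω) :
    |pathIntegral X V a b ω| ≤ K * (b - a) := by
  have h := intervalIntegral.norm_integral_le_of_norm_le_const (a := a) (b := b) (C := K)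
    (f := fun s => V (X s.toNNReal ω)) fun s _ => hK _
  rwa [abs_of_nonneg (sub_nonneg.2 hab)] at h

namespace IsCadlagMarkovFamily

section Moments

variable {E Ω : Type*} [TopologicalSpace E] [MeasurableSpace E] {mΩ : MeasurableSpace Ω}
  {ℱ : Filtration ℝ≥0 mΩ} {X : ℝ≥0 → Ω → E} {P : Kernel E Ω}

/-- Conditioning at the largest remaining time `h + a₀` replaces the last factor `G` by its
semigroup image, which is then merged with the factor at `a₀`. This is the reduction step for the
induction below. -/
theorem integral_prod_insert_mul (hX : IsCadlagMarkovFamily ℱ X P) (y : E) (h : ℝ≥0)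
    {I : Finset ℝ≥0} {a₀ a : ℝ≥0} (hI : ∀ i ∈ I, i < a₀) (ha : a₀ ≤ a)
    {g : ℝ≥0 → E → ℝ} (hg : ∀ i, Measurable (g i)) (hgb : ∀ i, ∃ K, ∀ x, |g i x| ≤ K)
    {G : E → ℝ} (hG : Measurable G) (hGb : ∃ K, ∀ x, |G x| ≤ K) :
    ∫ ω, (∏ i ∈ insert a₀ I, g i (X (h + i) ω)) * G (X (h + a) ω) ∂(P y) =
      ∫ ω, (∏ i ∈ I, g i (X (h + i) ω)) *
        (fun x => g a₀ x * markovSemigroup X P (a - a₀) G x) (X (h + a₀) ω) ∂(P y) := by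
  choose K hK using hgb
  obtain ⟨K', hK'⟩ := hGb
  have hm : Measurable[ℱ (h + a₀)] fun ω => ∏ i ∈ insert a₀ I, g i (X (h + i) ω) := by
    refine Finset.measurable_prod _ fun i hi => (hg i).comp ?_
    refine (hX.adapted (h + i)).mono (ℱ.mono ?_) le_rfl
    rcases Finset.mem_insert.1 hi with rfl | hi
    · exact le_rfl
    · exact add_le_add le_rfl (hI i hi).le
  have hb : ∀ ω, |∏ i ∈ insert a₀ I, g i (X (h + i) ω)| ≤ ∏ i ∈ insert a₀ I, K i := fun ω => by
    rw [Finset.abs_prod]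
    exact Finset.prod_le_prod (fun _ _ => abs_nonneg _) (fun i _ => hK _ _)
  have h1 := hX.integral_mul_comp y (h + a₀) (a - a₀) hm hb hG hK'
  rw [add_assoc, add_tsub_cancel_of_le ha] at h1
  rw [h1]
  have hn : a₀ ∉ I := fun hmem => (hI a₀ hmem).ne rfl
  refine integral_congr_ae (ae_of_all _ fun ω => ?_)
  simp only [Finset.prod_insert hn]
  ring

/-- Induction on the largest time. The separate last factor `G` must stay arbitrary, since each
conditioning changes it. The same reduction is applied on the right, for the process restarted from
`X h ω` with zero shift. -/
theorem integral_prod_mul_shift (hX : IsCadlagMarkovFamily ℱ X P) (x : E) (h : ℝ≥0)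
    (I : Finset ℝ≥0) {g : ℝ≥0 → E → ℝ} (hg : ∀ i, Measurable (g i))
    (hgb : ∀ i, ∃ K, ∀ x, |g i x| ≤ K) (a : ℝ≥0) (ha : ∀ i ∈ I, i ≤ a)
    {G : E → ℝ} (hG : Measurable G) (hGb : ∃ K, ∀ x, |G x| ≤ K) :
    ∫ ω, (∏ i ∈ I, g i (X (h + i) ω)) * G (X (h + a) ω) ∂(P x) =
      ∫ ω, ∫ ω', (∏ i ∈ I, g i (X i ω')) * G (X a ω') ∂(P (X h ω)) ∂(P x) := by
  induction I using Finset.induction_on_max generalizing a G with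
  | empty =>
    obtain ⟨K', hK'⟩ := hGb
    have h1 := hX.integral_mul_comp x h a (G := fun _ => 1) measurable_const (K := 1)
      (fun _ => by simp) hG hK'
    simpa [markovSemigroup] using h1
  | insert a₀ I hI ih =>
    have ha₀ : a₀ ≤ a := ha a₀ (Finset.mem_insert_self _ _)
    obtain ⟨K, hK⟩ := hgb a₀
    obtain ⟨K', hK'⟩ := hGb
    have hGm : Measurable fun x => g a₀ x * markovSemigroup X P (a - a₀) G x :=
      (hg a₀).mul (hX.measurable_markovSemigroup (a - a₀) hG)
    have hGb' : ∃ C, ∀ x, |g a₀ x * markovSemigroup X P (a - a₀) G x| ≤ C :=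
      ⟨K * K', fun x => by
        rw [abs_mul]
        exact mul_le_mul (hK x) (hX.abs_markovSemigroup_le _ hK' x) (abs_nonneg _)
          ((abs_nonneg _).trans (hK x))⟩
    rw [hX.integral_prod_insert_mul x h hI ha₀ hg hgb hG ⟨K', hK'⟩,
      ih a₀ (fun i hi => (hI i hi).le) hGm hGb']
    refine integral_congr_ae (ae_of_all _ fun ω => ?_)
    have h2 := hX.integral_prod_insert_mul (X h ω) 0 hI ha₀ hg hgb hG ⟨K', hK'⟩
    simp only [zero_add] at h2
    exact h2.symm

theorem integral_prod_shift (hX : IsCadlagMarkovFamily ℱ X P) (x : E) (h : ℝ≥0)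
    {V : E → ℝ} (hV : Measurable V) {K : ℝ} (hK : ∀ x, |V x| ≤ K) {n : ℕ} (s : Fin n → ℝ≥0) :
    ∫ ω, ∏ i, V (X (h + s i) ω) ∂(P x) =
      ∫ ω, ∫ ω', ∏ i, V (X (s i) ω') ∂(P (X h ω)) ∂(P x) := by
  classical
  -- Times may repeat: they are grouped into distinct ones, with multiplicities as exponents,
  -- because the induction runs over a finite set.
  let I : Finset ℝ≥0 := Finset.univ.image s
  let m : ℝ≥0 → ℕ := fun b => (Finset.univ.filter fun i => s i = b).card
  have h1 : ∀ (k : ℝ≥0) ω, ∏ i, V (X (k + s i) ω) =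
      (∏ b ∈ I, (fun b x => V x ^ m b) b (X (k + b) ω)) * (fun _ => 1) (X (k + I.sup id) ω) :=
    fun k ω => by
      simp only [mul_one]
      exact Finset.prod_comp (fun b => V (X (k + b) ω)) s
  have h2 : ∀ ω, ∏ i, V (X (s i) ω) =
      (∏ b ∈ I, (fun b x => V x ^ m b) b (X b ω)) * (fun _ => 1) (X (I.sup id) ω) :=
    fun ω => by simpa using h1 0 ω
  simp_rw [h1 h, h2]
  refine hX.integral_prod_mul_shift x h I (fun b => hV.pow_const (m b)) (fun b => ⟨K ^ m b, ?_⟩)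
    (I.sup id) (fun i hi => Finset.le_sup (f := id) hi) measurable_const ⟨1, by simp⟩
  intro x
  rw [abs_pow]
  exact pow_le_pow_left₀ (abs_nonneg _) (hK x) _

end Moments

section Path

variable {E Ω : Type*} [TopologicalSpace E] [TopologicalSpace.PseudoMetrizableSpace E]
  [MeasurableSpace E] [BorelSpace E] {mΩ : MeasurableSpace Ω}
  {ℱ : Filtration ℝ≥0 mΩ} {X : ℝ≥0 → Ω → E} {P : Kernel E Ω}

theorem measurable_uncurry (hX : IsCadlagMarkovFamily ℱ X P) :
    Measurable (fun p : ℝ≥0 × Ω => X p.1 p.2) :=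
  measurable_uncurry_of_continuousWithinAt_Ici hX.measurable hX.right_continuous

theorem measurable_comp_path (hX : IsCadlagMarkovFamily ℱ X P) {V : E → ℝ} (hV : Measurable V) :
    Measurable fun p : ℝ × Ω => V (X p.1.toNNReal p.2) :=
  hV.comp (hX.measurable_uncurry.comp
    ((measurable_real_toNNReal.comp measurable_fst).prodMk measurable_snd))

theorem intervalIntegrable_path (hX : IsCadlagMarkovFamily ℱ X P) {V : E → ℝ} (hV : Measurable V)
    {K : ℝ} (hK : ∀ x, |V x| ≤ K) (ω : Ω) (a b : ℝ) :
    IntervalIntegrable (fun s : ℝ => V (X s.toNNReal ω)) volume a b := by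
  refine (intervalIntegrable_const (c := K)).mono_fun ?_ (ae_of_all _ fun s => ?_)
  · exact ((hX.measurable_comp_path hV).comp
      (measurable_id.prodMk measurable_const)).aestronglyMeasurable
  · exact (hK _).trans (le_abs_self K)

theorem measurable_pathIntegral (hX : IsCadlagMarkovFamily ℱ X P) {V : E → ℝ}
    (hV : Measurable V) (a b : ℝ) : Measurable (pathIntegral X V a b) := by
  have h := (hX.measurable_comp_path hV).stronglyMeasurable
  exact h.integral_prod_left'.measurable.sub h.integral_prod_left'.measurable

theorem measurable_feynmanKac (hX : IsCadlagMarkovFamily ℱ X P) {V : E → ℝ}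
    (hV : Measurable V) (t : ℝ) : Measurable (feynmanKac X P V t) :=
  ((hX.measurable_pathIntegral hV 0 t).exp.stronglyMeasurable.integral_kernel (κ := P)).measurable

theorem pathIntegral_add (hX : IsCadlagMarkovFamily ℱ X P) {V : E → ℝ} (hV : Measurable V)
    {K : ℝ} (hK : ∀ x, |V x| ≤ K) (a b c : ℝ) (ω : Ω) :
    pathIntegral X V a b ω + pathIntegral X V b c ω = pathIntegral X V a c ω :=
  intervalIntegral.integral_add_adjacent_intervals (hX.intervalIntegrable_path hV hK ω a b)
    (hX.intervalIntegrable_path hV hK ω b c)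

/-- The Markov property for the functional `exp ∫_0^t V(X_s) ds` of the path. -/
theorem markovSemigroup_feynmanKac (hX : IsCadlagMarkovFamily ℱ X P) {V : E → ℝ}
    (hV : Measurable V) {K : ℝ} (hK : ∀ x, |V x| ≤ K) (h : ℝ≥0) {t : ℝ} (ht : 0 ≤ t) (x : E) :
    markovSemigroup X P h (feynmanKac X P V t) x =
      ∫ ω, Real.exp (pathIntegral X V h (h + t) ω) ∂(P x) := by
  have := hX.isMarkovKernel
  let κ := P.comap (X h) (hX.measurable h)
  have hκ : IsMarkovKernel κ := inferInstance
  have hY₁ := hX.measurable_comp_path hV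
  have hY₂ : Measurable fun p : ℝ × Ω => V (X (h + p.1.toNNReal) p.2) :=
    hV.comp (hX.measurable_uncurry.comp
      (((measurable_real_toNNReal.comp measurable_fst).const_add h).prodMk measurable_snd))
  -- `Ω` carries no shift map, so the path restarted at `X h` and the path of `X` after time `h` are
  -- compared through their mixed moments only.
  have key := integral_exp_integral_eq_of_moments ((P x).bind κ) (P x)
    (volume.restrict (Ioc 0 t)) (Y₁ := fun s ω => V (X s.toNNReal ω))
    (Y₂ := fun s ω => V (X (h + s.toNNReal) ω)) hY₁ hY₂ (fun _ _ => hK _) (fun _ _ => hK _) ?_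
  · rw [integral_bind_kernel] at key
    · convert key using 1
      · simp only [markovSemigroup, feynmanKac, pathIntegral,
          intervalIntegral.integral_of_le ht, κ, Kernel.comap_apply]
      · refine integral_congr_ae (ae_of_all _ fun ω => ?_)
        simp only [pathIntegral, Real.exp_eq_exp]
        have h1 := intervalIntegral.integral_comp_add_left
          (fun s : ℝ => V (X s.toNNReal ω)) (a := 0) (b := t) (h : ℝ)
        rw [add_zero] at h1
        rw [← h1, intervalIntegral.integral_of_le ht]
        refine setIntegral_congr_fun measurableSet_Ioc fun s hs => ?_
        simp only [Real.toNNReal_add h.coe_nonneg hs.1.le, Real.toNNReal_coe]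
    · have hmp := hX.measurable_pathIntegral hV 0 t
      refine Integrable.of_bound (C := Real.exp (K * (t - 0))) ?_ (ae_of_all _ fun ω => ?_)
      · change Measurable fun ω => ∫ s in (0 : ℝ)..t, V (X s.toNNReal ω) at hmp
        simp only [intervalIntegral.integral_of_le ht] at hmp
        exact hmp.exp.aestronglyMeasurable
      · rw [← intervalIntegral.integral_of_le ht, Real.norm_eq_abs, Real.abs_exp]
        exact Real.exp_le_exp.2 ((le_abs_self _).trans (abs_pathIntegral_le hK ht ω))
  · intro n s
    rw [integral_bind_kernel]
    · exact (hX.integral_prod_shift x h hV hK fun i => (s i).toNNReal).symm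
    · refine Integrable.of_bound (C := K ^ n) ?_ (ae_of_all _ fun ω => ?_)
      · exact (Finset.measurable_prod _ fun i _ =>
          hV.comp (hX.measurable _)).aestronglyMeasurable
      · rw [Real.norm_eq_abs, Finset.abs_prod]
        exact (Finset.prod_le_prod (fun _ _ => abs_nonneg _) (fun i _ => hK _)).trans (by simp)

end Path

end IsCadlagMarkovFamily

/-! ### Mean-square estimates. -/

theorem eLpNorm_two_eq {Ω : Type*} [MeasurableSpace Ω] (ν : Measure Ω) (Y : Ω → ℝ) :
    eLpNorm Y 2 ν = (∫⁻ ω, ‖Y ω‖ₑ ^ 2 ∂ν) ^ (1 / 2 : ℝ) := by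
  rw [eLpNorm_eq_lintegral_rpow_enorm_toReal two_ne_zero ENNReal.ofNat_ne_top]
  simp

theorem tendsto_eLpNorm_two_zero {Ω ι : Type*} [MeasurableSpace Ω] {ν : Measure Ω}
    {l : Filter ι} {Y : ι → Ω → ℝ}
    (h : Tendsto (fun i => ∫⁻ ω, ‖Y i ω‖ₑ ^ 2 ∂ν) l (𝓝 0)) :
    Tendsto (fun i => eLpNorm (Y i) 2 ν) l (𝓝 0) := by
  simp_rw [eLpNorm_two_eq]
  have h2 := (ENNReal.continuous_rpow_const (y := (1 / 2 : ℝ))).tendsto 0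
  rw [ENNReal.zero_rpow_of_pos (by norm_num)] at h2
  exact h2.comp h

theorem tendsto_lintegral_sq_zero {Ω ι : Type*} [MeasurableSpace Ω] {ν : Measure Ω}
    {l : Filter ι} {Y : ι → Ω → ℝ}
    (h : Tendsto (fun i => eLpNorm (Y i) 2 ν) l (𝓝 0)) :
    Tendsto (fun i => ∫⁻ ω, ‖Y i ω‖ₑ ^ 2 ∂ν) l (𝓝 0) := by
  simp_rw [eLpNorm_two_eq] at h
  have h2 := ((ENNReal.continuous_rpow_const (y := (2 : ℝ))).tendsto 0).comp h
  rw [ENNReal.zero_rpow_of_pos (by norm_num)] at h2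
  refine h2.congr fun i => ?_
  simp only [Function.comp]
  rw [← ENNReal.rpow_mul]
  norm_num

theorem enorm_integral_sq_le {Ω : Type*} [MeasurableSpace Ω] (ν : Measure Ω)
    [IsProbabilityMeasure ν] {Y : Ω → ℝ} (hY : AEStronglyMeasurable Y ν) :
    ‖∫ ω, Y ω ∂ν‖ₑ ^ 2 ≤ ∫⁻ ω, ‖Y ω‖ₑ ^ 2 ∂ν := by
  have h1 : ‖∫ ω, Y ω ∂ν‖ₑ ≤ eLpNorm Y 2 ν :=
    (enorm_integral_le_lintegral_enorm Y).trans
      (by rw [← eLpNorm_one_eq_lintegral_enorm]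
          exact eLpNorm_le_eLpNorm_of_exponent_le (by norm_num) hY)
  calc ‖∫ ω, Y ω ∂ν‖ₑ ^ 2 ≤ eLpNorm Y 2 ν ^ 2 := by gcongr
    _ = _ := by
      rw [eLpNorm_two_eq, ← ENNReal.rpow_natCast, ← ENNReal.rpow_mul]
      norm_num

/-- `x ↦ E^x[Y]` is a contraction from `L²(P^μ)` to `L²(μ)`. -/
theorem eLpNorm_integral_kernel_le {E Ω : Type*} [MeasurableSpace E] [MeasurableSpace Ω]
    (μ : Measure E) (P : Kernel E Ω) [IsMarkovKernel P] {Y : Ω → ℝ} (hY : Measurable Y) :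
    eLpNorm (fun x => ∫ ω, Y ω ∂(P x)) 2 μ ≤ eLpNorm Y 2 (μ.bind P) := by
  rw [eLpNorm_two_eq, eLpNorm_two_eq]
  gcongr
  rw [Measure.lintegral_bind P.aemeasurable (hY.enorm.pow_const 2).aemeasurable]
  exact lintegral_mono fun x => enorm_integral_sq_le (P x) hY.aestronglyMeasurable

/-- Since `|exp y - 1 - y| ≤ y²` for `|y| ≤ 1`, the bound `|y_h| ≤ L h` makes the quadratic
remainder `O(h)` uniformly after division by `h`. Only the linear term needs convergence in mean
square. -/
theorem tendsto_eLpNorm_mul_exp_sub {Ω : Type*} [MeasurableSpace Ω] {ν : Measure Ω}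
    [IsProbabilityMeasure ν] {Z Y : Ω → ℝ} {y : ℝ → Ω → ℝ} {M L : ℝ}
    (hY : Measurable Y) (hy : ∀ h, Measurable (y h))
    (hM : ∀ ω, |Z ω| ≤ M) (hL : ∀ h, 0 ≤ h → ∀ ω, |y h ω| ≤ L * h)
    (hlim : Tendsto (fun h => eLpNorm (fun ω => h⁻¹ * y h ω - Y ω) 2 ν) (𝓝[>] 0) (𝓝 0)) :
    Tendsto (fun h : ℝ => eLpNorm (fun ω => h⁻¹ * (Z ω * Real.exp (y h ω) - Z ω) - Z ω * Y ω) 2 ν)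
      (𝓝[>] 0) (𝓝 0) := by
  have hlim2 : Tendsto (fun h : ℝ => ENNReal.ofReal M *
      (eLpNorm (fun ω => h⁻¹ * y h ω - Y ω) 2 ν + ENNReal.ofReal (L ^ 2 * h)))
      (𝓝[>] 0) (𝓝 0) := by
    have h1 : Tendsto (fun h : ℝ => ENNReal.ofReal (L ^ 2 * h)) (𝓝[>] 0) (𝓝 0) := by
      have h0 : Tendsto (fun h : ℝ => L ^ 2 * h) (𝓝[>] 0) (𝓝 0) := by
        have : Continuous fun h : ℝ => L ^ 2 * h := by fun_prop
        simpa using (this.tendsto 0).mono_left nhdsWithin_le_nhds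
      simpa [Function.comp_def] using (ENNReal.continuous_ofReal.tendsto 0).comp h0
    have h2 := ENNReal.Tendsto.const_mul (a := ENNReal.ofReal M) (hlim.add h1)
      (Or.inr ENNReal.ofReal_ne_top)
    simpa using h2
  have hsmall : ∀ᶠ h : ℝ in 𝓝[>] 0, L * h ≤ 1 := by
    have h0 : Tendsto (fun h : ℝ => L * h) (𝓝[>] 0) (𝓝 0) := by
      have : Continuous fun h : ℝ => L * h := by fun_prop
      simpa using (this.tendsto 0).mono_left nhdsWithin_le_nhds
    exact (h0.eventually (gt_mem_nhds one_pos)).mono fun _ h => h.le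
  refine tendsto_of_tendsto_of_tendsto_of_le_of_le' tendsto_const_nhds hlim2
    (Eventually.of_forall fun _ => zero_le) ?_
  filter_upwards [hsmall, self_mem_nhdsWithin] with h hh (hpos : 0 < h)
  have hmeas : Measurable fun ω => h⁻¹ * y h ω - Y ω := ((hy h).const_mul _).sub hY
  calc eLpNorm (fun ω => h⁻¹ * (Z ω * Real.exp (y h ω) - Z ω) - Z ω * Y ω) 2 ν
      ≤ eLpNorm (fun ω => M * (‖h⁻¹ * y h ω - Y ω‖ + L ^ 2 * h)) 2 ν := by
        refine eLpNorm_mono_real fun ω => ?_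
        have e : h⁻¹ * (Z ω * Real.exp (y h ω) - Z ω) - Z ω * Y ω =
            Z ω * ((h⁻¹ * y h ω - Y ω) + h⁻¹ * (Real.exp (y h ω) - 1 - y h ω)) := by ring
        have hyb := hL h hpos.le ω
        have hexp := Real.abs_exp_sub_one_sub_id_le (hyb.trans hh)
        have h3 : |h⁻¹ * (Real.exp (y h ω) - 1 - y h ω)| ≤ L ^ 2 * h := by
          rw [abs_mul, abs_of_pos (inv_pos.2 hpos), inv_mul_le_iff₀ hpos]
          refine hexp.trans ?_
          rw [← sq_abs]
          calc |y h ω| ^ 2 ≤ (L * h) ^ 2 := by gcongr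
            _ = _ := by ring
        rw [e, Real.norm_eq_abs, abs_mul]
        refine mul_le_mul (hM ω) ((abs_add_le _ _).trans ?_) (abs_nonneg _)
          ((abs_nonneg _).trans (hM ω))
        rw [Real.norm_eq_abs]
        gcongr
    _ ≤ ENNReal.ofReal M *
      (eLpNorm (fun ω => h⁻¹ * y h ω - Y ω) 2 ν + ENNReal.ofReal (L ^ 2 * h)) := by
        rcases isEmpty_or_nonempty Ω with hΩ | ⟨⟨ω₀⟩⟩
        · have : eLpNorm (fun ω => M * (‖h⁻¹ * y h ω - Y ω‖ + L ^ 2 * h)) 2 ν = 0 := by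
            simp [Measure.eq_zero_of_isEmpty]
          rw [this]
          exact zero_le
        have hM0 : 0 ≤ M := (abs_nonneg _).trans (hM ω₀)
        have h4 := eLpNorm_const_smul (c := M) (p := 2) (μ := ν)
          (f := fun ω => ‖h⁻¹ * y h ω - Y ω‖ + L ^ 2 * h)
        have h5 : (M • fun ω => ‖h⁻¹ * y h ω - Y ω‖ + L ^ 2 * h) =
          fun ω => M * (‖h⁻¹ * y h ω - Y ω‖ + L ^ 2 * h) := rfl
        rw [h5, Real.enorm_of_nonneg hM0] at h4
        rw [h4]
        gcongr
        refine (eLpNorm_add_le hmeas.norm.aestronglyMeasurable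
          aestronglyMeasurable_const (by norm_num)).trans ?_
        rw [eLpNorm_norm]
        gcongr
        rw [eLpNorm_const _ two_ne_zero (IsProbabilityMeasure.ne_zero ν), measure_univ,
          ENNReal.one_rpow, mul_one, Real.enorm_of_nonneg (by positivity)]

/-! ### Mean-square continuity and differentiation along the stationary process. -/

section Path

variable {E Ω : Type*} [TopologicalSpace E] [MeasurableSpace E] {mΩ : MeasurableSpace Ω}
  {ℱ : Filtration ℝ≥0 mΩ} {X : ℝ≥0 → Ω → E} {P : Kernel E Ω}

theorem IsInvariantLaw.eLpNorm_comp {μ : Measure E} (hinv : IsInvariantLaw X P μ)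
    (hX : IsCadlagMarkovFamily ℱ X P) (t : ℝ≥0) {g : E → ℝ} (hg : AEStronglyMeasurable g μ) :
    eLpNorm (fun ω => g (X t ω)) 2 (μ.bind P) = eLpNorm g 2 μ := by
  have h := hinv t
  conv_rhs => rw [← h]
  rw [eLpNorm_map_measure (by rwa [h]) (hX.measurable t).aemeasurable]
  rfl

variable [TopologicalSpace.PseudoMetrizableSpace E] [BorelSpace E]

/-- For a stationary càdlàg process, `s ↦ V(X_s)` is right-continuous in mean square. -/
theorem IsInvariantLaw.tendsto_eLpNorm_comp_sub {μ : Measure E} [IsProbabilityMeasure μ]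
    (hinv : IsInvariantLaw X P μ) (hX : IsCadlagMarkovFamily ℱ X P) {V : E → ℝ}
    (hV : Measurable V) {K : ℝ} (hK : ∀ x, |V x| ≤ K) (t : ℝ≥0) :
    Tendsto (fun s => eLpNorm (fun ω => V (X s ω) - V (X t ω)) 2 (μ.bind P)) (𝓝[≥] t) (𝓝 0) := by
  let _ := TopologicalSpace.pseudoMetrizableSpacePseudoMetric E
  have := hX.isMarkovKernel
  rw [ENNReal.tendsto_nhds_zero]
  intro ε hε
  have hVm : MemLp V 2 μ := MemLp.of_bound hV.aestronglyMeasurable K (ae_of_all _ hK)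
  -- `V` is merely measurable, so it is replaced by a bounded continuous `φ`, for which
  -- right-continuity of paths suffices. By stationarity the replacement error in `L²` is the same
  -- at every time.
  obtain ⟨φ, hφ, hφm⟩ := hVm.exists_boundedContinuous_eLpNorm_sub_le ENNReal.ofNat_ne_top
    (ε := ε / 3) (ENNReal.div_pos hε.ne' (by norm_num)).ne'
  have hφc : Measurable φ := φ.continuous.measurable
  have hcont : Tendsto (fun s => eLpNorm (fun ω => φ (X s ω) - φ (X t ω)) 2 (μ.bind P))
      (𝓝[≥] t) (𝓝 0) := by
    refine tendsto_eLpNorm_two_zero ?_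
    have h := tendsto_lintegral_filter_of_dominated_convergence
      (F := fun s ω => ‖φ (X s ω) - φ (X t ω)‖ₑ ^ 2) (f := fun _ => 0) (μ := μ.bind P)
      (l := 𝓝[≥] t) (fun _ => ENNReal.ofReal (2 * ‖φ‖) ^ 2)
      (Eventually.of_forall fun s =>
        ((hφc.comp (hX.measurable s)).sub (hφc.comp (hX.measurable t))).enorm.pow_const 2)
      (Eventually.of_forall fun s => ae_of_all _ fun ω => ?_) ?_ (ae_of_all _ fun ω => ?_)
    · simpa using h
    · refine pow_le_pow_left' ?_ 2
      rw [← ofReal_norm]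
      rw [← dist_eq_norm]
      exact ENNReal.ofReal_le_ofReal (φ.dist_le_two_norm _ _)
    · simp [ENNReal.mul_eq_top]
    · have h1 : Tendsto (fun s => φ (X s ω) - φ (X t ω)) (𝓝[≥] t) (𝓝 0) := by
        have h2 := (φ.continuous.tendsto (X t ω)).comp (hX.right_continuous ω t)
        simpa using h2.sub_const (φ (X t ω))
      have h3 := (ENNReal.continuous_pow 2).tendsto 0 |>.comp
        ((continuous_enorm.tendsto (0 : ℝ)).comp h1 |>.trans (by simp))
      simpa [Function.comp_def] using h3
  have hd : AEStronglyMeasurable (V - ⇑φ) μ := (hV.sub hφc).aestronglyMeasurable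
  filter_upwards [ENNReal.tendsto_nhds_zero.1 hcont (ε / 3)
    (ENNReal.div_pos hε.ne' (by norm_num))] with s hs
  have e : (fun ω => V (X s ω) - V (X t ω)) =
      ((fun ω => (V - ⇑φ) (X s ω)) + fun ω => φ (X s ω) - φ (X t ω)) -
        fun ω => (V - ⇑φ) (X t ω) := by
    funext ω
    simp only [Pi.add_apply, Pi.sub_apply]
    ring
  have m1 : ∀ r, AEStronglyMeasurable (fun ω => (V - ⇑φ) (X r ω)) (μ.bind P) := fun r =>
    ((hV.sub hφc).comp (hX.measurable r)).aestronglyMeasurable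
  have m2 : AEStronglyMeasurable (fun ω => φ (X s ω) - φ (X t ω)) (μ.bind P) :=
    ((hφc.comp (hX.measurable s)).sub (hφc.comp (hX.measurable t))).aestronglyMeasurable
  rw [e]
  refine (eLpNorm_sub_le ((m1 s).add m2) (m1 t) (by norm_num)).trans ?_
  refine (add_le_add_left (eLpNorm_add_le (m1 s) m2 (by norm_num)) _).trans ?_
  rw [hinv.eLpNorm_comp hX s hd, hinv.eLpNorm_comp hX t hd]
  refine (add_le_add (add_le_add hφ hs) hφ).trans ?_
  rw [ENNReal.add_thirds]

/-- After the substitution `s = t + h θ` the error is an average over `θ ∈ (0, 1]` of increments of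
`V(X)`. Jensen, Tonelli and dominated convergence reduce it to mean-square right-continuity at `t`.
-/
theorem IsInvariantLaw.tendsto_eLpNorm_pathIntegral {μ : Measure E} [IsProbabilityMeasure μ]
    (hinv : IsInvariantLaw X P μ) (hX : IsCadlagMarkovFamily ℱ X P) {V : E → ℝ}
    (hV : Measurable V) {K : ℝ} (hK : ∀ x, |V x| ≤ K) (t : ℝ) :
    Tendsto (fun h : ℝ => eLpNorm
      (fun ω => h⁻¹ * pathIntegral X V t (t + h) ω - V (X t.toNNReal ω)) 2 (μ.bind P))
      (𝓝[>] 0) (𝓝 0) := by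
  have := hX.isMarkovKernel
  let τ : Measure ℝ := volume.restrict (Ioc 0 1)
  have hτ : IsProbabilityMeasure τ := ⟨by simp [τ]⟩
  let w : ℝ → ℝ → Ω → ℝ := fun h θ ω => V (X (t + h * θ).toNNReal ω) - V (X t.toNNReal ω)
  have hw : ∀ h, Measurable fun p : ℝ × Ω => w h p.1 p.2 := fun h => by
    refine Measurable.sub ?_ ?_
    · have h2 : Measurable fun p : ℝ × Ω => (t + h * p.1, p.2) := by fun_prop
      exact (hX.measurable_comp_path hV).comp h2
    · exact hV.comp ((hX.measurable _).comp measurable_snd)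
  have hwK : ∀ h θ ω, |w h θ ω| ≤ 2 * K := fun h θ ω =>
    (abs_sub _ _).trans (by linarith [hK (X (t + h * θ).toNNReal ω), hK (X t.toNNReal ω)])
  have hpath : ∀ h : ℝ, 0 < h → ∀ ω,
      h⁻¹ * pathIntegral X V t (t + h) ω - V (X t.toNNReal ω) = ∫ θ, w h θ ω ∂τ := by
    intro h hh ω
    have h1 := intervalIntegral.integral_comp_add_mul (a := 0) (b := 1)
      (fun s : ℝ => V (X s.toNNReal ω)) hh.ne' t
    simp only [mul_zero, add_zero, mul_one, smul_eq_mul] at h1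
    simp only [pathIntegral, τ]
    rw [← h1, intervalIntegral.integral_of_le zero_le_one, integral_sub, integral_const]
    · simp
    · refine Integrable.of_bound (C := K) ?_ (ae_of_all _ fun θ => hK _)
      have h2 : Measurable fun θ : ℝ => (t + h * θ, ω) := by fun_prop
      exact ((hX.measurable_comp_path hV).comp h2).aestronglyMeasurable
    · exact integrable_const _
  have hint : Tendsto (fun h : ℝ => ∫⁻ θ, ∫⁻ ω, ‖w h θ ω‖ₑ ^ 2 ∂(μ.bind P) ∂τ)
      (𝓝[>] 0) (𝓝 0) := by
    have h := tendsto_lintegral_filter_of_dominated_convergence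
      (F := fun h θ => ∫⁻ ω, ‖w h θ ω‖ₑ ^ 2 ∂(μ.bind P)) (f := fun _ => 0) (μ := τ)
      (l := 𝓝[>] (0 : ℝ)) (fun _ => ENNReal.ofReal (2 * K) ^ 2)
      (Eventually.of_forall fun h => ((hw h).enorm.pow_const 2).lintegral_prod_right')
      (Eventually.of_forall fun h => ae_of_all _ fun θ => ?_) ?_ ?_
    · simpa using h
    · refine (lintegral_mono (g := fun _ => ENNReal.ofReal (2 * K) ^ 2) fun ω => ?_).trans
        (by simp)
      refine pow_le_pow_left' ?_ 2
      rw [← ofReal_norm]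
      exact ENNReal.ofReal_le_ofReal (hwK h θ ω)
    · simp [ENNReal.mul_eq_top]
    · refine (ae_restrict_iff' measurableSet_Ioc).2 (ae_of_all _ fun θ hθ => ?_)
      refine tendsto_lintegral_sq_zero ?_
      refine (hinv.tendsto_eLpNorm_comp_sub hX hV hK t.toNNReal).comp ?_
      refine tendsto_nhdsWithin_iff.2 ⟨?_, ?_⟩
      · have hc : Continuous fun h : ℝ => (t + h * θ).toNNReal := by fun_prop
        simpa using (hc.tendsto 0).mono_left nhdsWithin_le_nhds
      · filter_upwards [self_mem_nhdsWithin] with h (hh : 0 < h)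
        exact Real.toNNReal_le_toNNReal (by nlinarith [mul_pos hh hθ.1])
  refine tendsto_eLpNorm_two_zero ?_
  refine tendsto_of_tendsto_of_tendsto_of_le_of_le' tendsto_const_nhds hint
    (Eventually.of_forall fun _ => zero_le) ?_
  filter_upwards [self_mem_nhdsWithin] with h (hh : 0 < h)
  rw [lintegral_lintegral_swap ((hw h).enorm.pow_const 2).aemeasurable]
  refine lintegral_mono fun ω => ?_
  rw [hpath h hh]
  exact enorm_integral_sq_le τ
    ((hw h).comp (measurable_id.prodMk measurable_const)).aestronglyMeasurable

end Path

/-! ### Differentiability of the Feynman–Kac function and membership in the generator domain. -/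

/-- The derivative `E^x[exp(∫_0^t V(X_s) ds) V(X_t)]` of the Feynman–Kac function in `t`. -/
noncomputable def feynmanKacDeriv {E Ω : Type*} [MeasurableSpace E] [MeasurableSpace Ω]
    (X : ℝ≥0 → Ω → E) (P : Kernel E Ω) (V : E → ℝ) (t : ℝ) (x : E) : ℝ :=
  ∫ ω, Real.exp (pathIntegral X V 0 t ω) * V (X t.toNNReal ω) ∂(P x)

theorem abs_exp_sub_exp_le {a b M : ℝ} (ha : a ≤ M) (hb : b ≤ M) :
    |Real.exp a - Real.exp b| ≤ Real.exp M * |a - b| := by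
  wlog hab : b ≤ a generalizing a b
  · rw [abs_sub_comm, abs_sub_comm a]
    exact this hb ha (le_of_not_ge hab)
  rw [abs_of_nonneg (sub_nonneg.2 (Real.exp_le_exp.2 hab)), abs_of_nonneg (sub_nonneg.2 hab)]
  have h1 : Real.exp b = Real.exp a * Real.exp (b - a) := by rw [← Real.exp_add]; ring_nf
  have h2 := Real.add_one_le_exp (b - a)
  calc Real.exp a - Real.exp b = Real.exp a * (1 - Real.exp (b - a)) := by rw [h1]; ring
    _ ≤ Real.exp a * (a - b) :=
      mul_le_mul_of_nonneg_left (by linarith) (Real.exp_pos a).le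
    _ ≤ Real.exp M * (a - b) := by
      have := sub_nonneg.2 hab
      gcongr

theorem integral_const_mul_sub_sub {Ω : Type*} [MeasurableSpace Ω] {ν : Measure Ω} (r : ℝ)
    {a b d : Ω → ℝ} (ha : Integrable a ν) (hb : Integrable b ν) (hd : Integrable d ν) :
    ∫ ω, r * (a ω - b ω) - d ω ∂ν = r * (∫ ω, a ω ∂ν - ∫ ω, b ω ∂ν) - ∫ ω, d ω ∂ν := by
  have hab : Integrable (fun ω => r * (a ω - b ω)) ν := (ha.sub hb).const_mul r
  rw [integral_sub hab hd, integral_const_mul, integral_sub ha hb]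

theorem exp_pathIntegral_le {E Ω : Type*} {X : ℝ≥0 → Ω → E} {V : E → ℝ} {K : ℝ}
    (hK : ∀ x, |V x| ≤ K) {a b : ℝ} (hab : a ≤ b) (ω : Ω) :
    |Real.exp (pathIntegral X V a b ω)| ≤ Real.exp (K * (b - a)) := by
  rw [Real.abs_exp]
  exact Real.exp_le_exp.2 ((le_abs_self _).trans (abs_pathIntegral_le hK hab ω))

theorem abs_exp_mul_le {E Ω : Type*} {X : ℝ≥0 → Ω → E} {V : E → ℝ} {K : ℝ}
    (hK : ∀ x, |V x| ≤ K) {t : ℝ} (ht : 0 ≤ t) (s : ℝ≥0) (ω : Ω) :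
    |Real.exp (pathIntegral X V 0 t ω) * V (X s ω)| ≤ Real.exp (K * (t - 0)) * K := by
  rw [abs_mul]
  exact mul_le_mul (exp_pathIntegral_le hK ht ω) (hK _) (abs_nonneg _) (Real.exp_pos _).le

section Generator

variable {E Ω : Type*} [TopologicalSpace E] [MeasurableSpace E] {mΩ : MeasurableSpace Ω}
  {ℱ : Filtration ℝ≥0 mΩ} {X : ℝ≥0 → Ω → E} {P : Kernel E Ω} {μ : Measure E}

theorem IsCadlagMarkovFamily.abs_feynmanKac_le {V : E → ℝ} {K : ℝ} (hX : IsCadlagMarkovFamily ℱ X P)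
    (hK : ∀ x, |V x| ≤ K) {t : ℝ} (ht : 0 ≤ t) (x : E) : |feynmanKac X P V t x| ≤ Real.exp (K * t) := by
  have := hX.isMarkovKernel
  have h := norm_integral_le_of_norm_le_const (μ := P x) (C := Real.exp (K * (t - 0)))
    (f := fun ω => Real.exp (pathIntegral X V 0 t ω))
    (ae_of_all _ fun ω => exp_pathIntegral_le (X := X) hK ht ω)
  simpa [feynmanKac] using h

theorem IsCadlagMarkovFamily.abs_feynmanKacDeriv_le {V : E → ℝ} {K : ℝ} (hX : IsCadlagMarkovFamily ℱ X P)
    (hK : ∀ x, |V x| ≤ K) {t : ℝ} (ht : 0 ≤ t) (x : E) : |feynmanKacDeriv X P V t x| ≤ Real.exp (K * t) * K := by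
  have := hX.isMarkovKernel
  have h := norm_integral_le_of_norm_le_const (μ := P x) (C := Real.exp (K * (t - 0)) * K)
    (f := fun ω => Real.exp (pathIntegral X V 0 t ω) * V (X t.toNNReal ω))
    (ae_of_all _ fun ω => abs_exp_mul_le (X := X) hK ht t.toNNReal ω)
  simpa [feynmanKacDeriv] using h

/-- Invariance is what lets the semigroup act on `L²(μ)` classes: a `μ`-null set is also null for
the law of `X_t` under `P^μ`. -/
theorem IsInvariantLaw.markovSemigroup_congr (hinv : IsInvariantLaw X P μ)
    (hX : IsCadlagMarkovFamily ℱ X P) (t : ℝ≥0) {g g' : E → ℝ} (h : g =ᵐ[μ] g') :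
    markovSemigroup X P t g =ᵐ[μ] markovSemigroup X P t g' := by
  have h1 : ∀ᵐ y ∂((μ.bind P).map (X t)), g y = g' y := by rwa [hinv t]
  have h2 := Measure.ae_ae_of_ae_comp (ae_of_ae_map (hX.measurable t).aemeasurable h1)
  exact h2.mono fun x hx => integral_congr_ae hx

theorem IsInvariantLaw.generatorGraph_toLp (hinv : IsInvariantLaw X P μ)
    (hX : IsCadlagMarkovFamily ℱ X P) {g a : E → ℝ} (hg : MemLp g 2 μ) (ha : MemLp a 2 μ)
    (h : Tendsto (fun s : ℝ => eLpNorm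
      (fun x => s⁻¹ * (markovSemigroup X P s.toNNReal g x - g x) - a x) 2 μ) (𝓝[>] 0) (𝓝 0)) :
    GeneratorGraph X P μ (hg.toLp g) (ha.toLp a) := by
  have hc : Tendsto (fun s : ℝ≥0 => (s : ℝ)) (𝓝[>] 0) (𝓝[>] 0) :=
    tendsto_nhdsWithin_iff.2 ⟨(NNReal.continuous_coe.tendsto 0).mono_left nhdsWithin_le_nhds,
      by filter_upwards [self_mem_nhdsWithin] with s (hs : 0 < s) using NNReal.coe_pos.2 hs⟩
  refine (h.comp hc).congr fun s => eLpNorm_congr_ae ?_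
  filter_upwards [hg.coeFn_toLp, ha.coeFn_toLp,
    hinv.markovSemigroup_congr hX s hg.coeFn_toLp] with x h1 h2 h3
  rw [h1, h2, h3, Real.toNNReal_coe]

/-- Invariance gives every difference quotient mean zero, and this passes to the `L²` limit. It
provides `⟨A h, 1⟩ = 0` in the energy estimate. -/
theorem IsInvariantLaw.integral_eq_zero_of_tendsto [IsProbabilityMeasure μ]
    (hinv : IsInvariantLaw X P μ)
    (hX : IsCadlagMarkovFamily ℱ X P) {g a : E → ℝ} (hg : Measurable g) {K : ℝ}
    (hK : ∀ x, |g x| ≤ K) (ha : MemLp a 2 μ)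
    (h : Tendsto (fun s : ℝ => eLpNorm
      (fun x => s⁻¹ * (markovSemigroup X P s.toNNReal g x - g x) - a x) 2 μ) (𝓝[>] 0) (𝓝 0)) :
    ∫ x, a x ∂μ = 0 := by
  have := hX.isMarkovKernel
  have h1 := tendsto_lintegral_sq_zero h
  have hgi : Integrable g μ := Integrable.of_bound hg.aestronglyMeasurable K (ae_of_all _ hK)
  have hPi : ∀ s, Integrable (markovSemigroup X P s g) μ := fun s =>
    Integrable.of_bound (hX.measurable_markovSemigroup s hg).aestronglyMeasurable K
      (ae_of_all _ fun x => hX.abs_markovSemigroup_le s hK x)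
  have hPg : ∀ s, ∫ x, markovSemigroup X P s g x ∂μ = ∫ x, g x ∂μ := fun s => by
    conv_rhs => rw [← hinv s]
    rw [integral_map (hX.measurable s).aemeasurable hg.aestronglyMeasurable,
      integral_bind_kernel]
    · rfl
    · exact Integrable.of_bound (hg.comp (hX.measurable s)).aestronglyMeasurable K
        (ae_of_all _ fun ω => hK _)
  have hai : Integrable a μ := ha.integrable (by norm_num)
  have h2 : ∀ s : ℝ, ‖∫ x, a x ∂μ‖ₑ ^ 2 ≤
      ∫⁻ x, ‖s⁻¹ * (markovSemigroup X P s.toNNReal g x - g x) - a x‖ₑ ^ 2 ∂μ := fun s => by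
    have hi := ((hPi s.toNNReal).sub hgi).const_mul s⁻¹
    refine le_trans (le_of_eq ?_) (enorm_integral_sq_le μ (hi.sub hai).aestronglyMeasurable)
    rw [integral_const_mul_sub_sub _ (hPi _) hgi hai, hPg]
    simp
  have h3 := le_of_tendsto_of_tendsto' tendsto_const_nhds h1 h2
  have h4 := pow_eq_zero_iff (two_ne_zero) |>.1 (le_zero_iff.1 h3)
  simpa using h4

end Generator

section Path

variable {E Ω : Type*} [TopologicalSpace E] [TopologicalSpace.PseudoMetrizableSpace E]
  [MeasurableSpace E] [BorelSpace E] {mΩ : MeasurableSpace Ω}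
  {ℱ : Filtration ℝ≥0 mΩ} {X : ℝ≥0 → Ω → E} {P : Kernel E Ω} {μ : Measure E} {V : E → ℝ} {K : ℝ}

namespace IsCadlagMarkovFamily

theorem integrable_exp_pathIntegral (hX : IsCadlagMarkovFamily ℱ X P) (hV : Measurable V)
    (hK : ∀ x, |V x| ≤ K) {a b : ℝ} (hab : a ≤ b) (ν : Measure Ω) [IsFiniteMeasure ν] :
    Integrable (fun ω => Real.exp (pathIntegral X V a b ω)) ν :=
  Integrable.of_bound (hX.measurable_pathIntegral hV a b).exp.aestronglyMeasurable _
    (ae_of_all _ fun ω => exp_pathIntegral_le hK hab ω)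

theorem measurable_feynmanKacDeriv (hX : IsCadlagMarkovFamily ℱ X P) (hV : Measurable V)
    (t : ℝ) : Measurable (feynmanKacDeriv X P V t) :=
  (((hX.measurable_pathIntegral hV 0 t).exp.mul
    (hV.comp (hX.measurable t.toNNReal))).stronglyMeasurable.integral_kernel (κ := P)).measurable

theorem integrable_exp_mul (hX : IsCadlagMarkovFamily ℱ X P) (hV : Measurable V)
    (hK : ∀ x, |V x| ≤ K) {t : ℝ} (ht : 0 ≤ t) (s : ℝ≥0) (ν : Measure Ω) [IsFiniteMeasure ν] :
    Integrable (fun ω => Real.exp (pathIntegral X V 0 t ω) * V (X s ω)) ν :=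
  Integrable.of_bound ((hX.measurable_pathIntegral hV 0 t).exp.mul
    (hV.comp (hX.measurable s))).aestronglyMeasurable _
    (ae_of_all _ fun ω => abs_exp_mul_le hK ht s ω)

theorem abs_feynmanKac_sub_le (hX : IsCadlagMarkovFamily ℱ X P) (hV : Measurable V)
    (hK : ∀ x, |V x| ≤ K) {s t T : ℝ}
    (hs : s ∈ Icc 0 T) (ht : t ∈ Icc 0 T) (x : E) :
    |feynmanKac X P V s x - feynmanKac X P V t x| ≤ Real.exp (K * T) * (K * |s - t|) := by
  have := hX.isMarkovKernel
  have hK0 : 0 ≤ K := (abs_nonneg _).trans (hK x)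
  wlog hst : t ≤ s generalizing s t
  · rw [abs_sub_comm, abs_sub_comm s]
    exact this ht hs (le_of_not_ge hst)
  have hb : ∀ r ∈ Icc 0 T, ∀ ω, pathIntegral X V 0 r ω ≤ K * T := fun r hr ω => by
    refine (le_abs_self _).trans ((abs_pathIntegral_le hK hr.1 ω).trans ?_)
    rw [sub_zero]
    exact mul_le_mul_of_nonneg_left hr.2 hK0
  have h := norm_integral_le_of_norm_le_const (μ := P x)
    (f := fun ω => Real.exp (pathIntegral X V 0 s ω) - Real.exp (pathIntegral X V 0 t ω))
    (C := Real.exp (K * T) * (K * |s - t|)) (ae_of_all _ fun ω => by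
      refine (abs_exp_sub_exp_le (hb s hs ω) (hb t ht ω)).trans ?_
      rw [← hX.pathIntegral_add hV hK 0 t s, add_sub_cancel_left, abs_of_nonneg (sub_nonneg.2 hst)]
      gcongr
      exact abs_pathIntegral_le hK hst ω)
  rw [integral_sub (hX.integrable_exp_pathIntegral hV hK hs.1 _)
    (hX.integrable_exp_pathIntegral hV hK ht.1 _)] at h
  simpa [feynmanKac] using h

end IsCadlagMarkovFamily

/-- As `x ↦ E^x[Y]` contracts `L²(P^μ)` into `L²(μ)`, it is enough to differentiate `exp ∫_0^t
V(X_s) ds` on path space. -/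
theorem IsInvariantLaw.tendsto_feynmanKac_slope [IsProbabilityMeasure μ]
    (hinv : IsInvariantLaw X P μ) (hX : IsCadlagMarkovFamily ℱ X P) (hV : Measurable V)
    (hK : ∀ x, |V x| ≤ K) {t : ℝ} (ht : 0 ≤ t) :
    Tendsto (fun h : ℝ => eLpNorm (fun x => h⁻¹ * (feynmanKac X P V (t + h) x -
      feynmanKac X P V t x) - feynmanKacDeriv X P V t x) 2 μ) (𝓝[>] 0) (𝓝 0) := by
  have := hX.isMarkovKernel
  let Z : Ω → ℝ := fun ω => Real.exp (pathIntegral X V 0 t ω)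
  have hZ : Measurable Z := (hX.measurable_pathIntegral hV 0 t).exp
  have hVt : Measurable fun ω => V (X t.toNNReal ω) := hV.comp (hX.measurable _)
  have h1 := tendsto_eLpNorm_mul_exp_sub (ν := μ.bind P) (Z := Z)
    (Y := fun ω => V (X t.toNNReal ω)) (y := fun h => pathIntegral X V t (t + h)) (L := K)
    hVt (fun h => hX.measurable_pathIntegral hV _ _)
    (fun ω => exp_pathIntegral_le hK ht ω)
    (fun h hh ω => (abs_pathIntegral_le hK (by linarith) ω).trans_eq (by ring))
    (hinv.tendsto_eLpNorm_pathIntegral hX hV hK t)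
  refine tendsto_of_tendsto_of_tendsto_of_le_of_le' tendsto_const_nhds h1
    (Eventually.of_forall fun _ => zero_le) ?_
  filter_upwards [self_mem_nhdsWithin] with h (hh : 0 < h)
  have hm : Measurable fun ω => h⁻¹ * (Z ω * Real.exp (pathIntegral X V t (t + h) ω) - Z ω) -
      Z ω * V (X t.toNNReal ω) :=
    (((hZ.mul (hX.measurable_pathIntegral hV _ _).exp).sub hZ).const_mul _).sub (hZ.mul hVt)
  refine le_trans (le_of_eq ?_) (eLpNorm_integral_kernel_le μ P hm)
  congr 1
  funext x
  have e : ∀ ω, Z ω * Real.exp (pathIntegral X V t (t + h) ω) =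
      Real.exp (pathIntegral X V 0 (t + h) ω) := fun ω => by
    simp only [Z]
    rw [← Real.exp_add, hX.pathIntegral_add hV hK]
  simp_rw [e]
  have i1 := hX.integrable_exp_pathIntegral hV hK (add_nonneg ht hh.le) (P x)
  have i2 := hX.integrable_exp_pathIntegral hV hK ht (P x)
  have i3 := hX.integrable_exp_mul hV hK ht t.toNNReal (P x)
  exact (integral_const_mul_sub_sub h⁻¹ i1 i2 i3).symm

/-- This identifies `A u_t = u_t' - V u_t`. Sliding the window `[0, t]` to `[h, h + t]` multiplies
the exponential by `exp(∫_t^{t+h} V - ∫_0^h V)`, whose derivative at `h = 0` is `V(X_t) - V(X_0)`,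
and `X_0 = x` almost surely under `P^x`. -/
theorem IsInvariantLaw.tendsto_markovSemigroup_feynmanKac [IsProbabilityMeasure μ]
    (hinv : IsInvariantLaw X P μ) (hX : IsCadlagMarkovFamily ℱ X P) (hV : Measurable V)
    (hK : ∀ x, |V x| ≤ K) {t : ℝ} (ht : 0 ≤ t) :
    Tendsto (fun h : ℝ => eLpNorm (fun x => h⁻¹ *
      (markovSemigroup X P h.toNNReal (feynmanKac X P V t) x - feynmanKac X P V t x) -
      (feynmanKacDeriv X P V t x - V x * feynmanKac X P V t x)) 2 μ) (𝓝[>] 0) (𝓝 0) := by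
  have := hX.isMarkovKernel
  let Z : Ω → ℝ := fun ω => Real.exp (pathIntegral X V 0 t ω)
  have hZ : Measurable Z := (hX.measurable_pathIntegral hV 0 t).exp
  have hVs : ∀ s, Measurable fun ω => V (X s ω) := fun s => hV.comp (hX.measurable s)
  let y : ℝ → Ω → ℝ := fun h ω => pathIntegral X V t (t + h) ω - pathIntegral X V 0 (0 + h) ω
  have hy : ∀ h, Measurable (y h) := fun h =>
    (hX.measurable_pathIntegral hV _ _).sub (hX.measurable_pathIntegral hV _ _)
  have hlim : Tendsto (fun h : ℝ => eLpNorm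
      (fun ω => h⁻¹ * y h ω - (V (X t.toNNReal ω) - V (X 0 ω))) 2 (μ.bind P))
      (𝓝[>] 0) (𝓝 0) := by
    have h1 := (hinv.tendsto_eLpNorm_pathIntegral hX hV hK t).add
      (hinv.tendsto_eLpNorm_pathIntegral hX hV hK 0)
    rw [add_zero] at h1
    refine tendsto_of_tendsto_of_tendsto_of_le_of_le tendsto_const_nhds h1
      (fun _ => zero_le) fun h => ?_
    have m1 : ∀ r, AEStronglyMeasurable
        (fun ω => h⁻¹ * pathIntegral X V r (r + h) ω - V (X r.toNNReal ω)) (μ.bind P) := fun r =>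
      (((hX.measurable_pathIntegral hV _ _).const_mul _).sub (hVs _)).aestronglyMeasurable
    refine le_trans (le_of_eq ?_) (eLpNorm_sub_le (m1 t) (m1 0) (by norm_num))
    congr 1
    funext ω
    simp only [y, Pi.sub_apply, Real.toNNReal_zero]
    ring
  have h1 := tendsto_eLpNorm_mul_exp_sub (ν := μ.bind P) (Z := Z) (L := 2 * K)
    ((hVs t.toNNReal).sub (hVs 0)) hy
    (fun ω => exp_pathIntegral_le hK ht ω)
    (fun h hh ω => by
      have a1 := abs_pathIntegral_le (X := X) hK (show t ≤ t + h by linarith) ω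
      have a2 := abs_pathIntegral_le (X := X) hK (show 0 ≤ 0 + h by linarith) ω
      refine (abs_sub _ _).trans ((add_le_add a1 a2).trans_eq (by ring))) hlim
  refine tendsto_of_tendsto_of_tendsto_of_le_of_le' tendsto_const_nhds h1
    (Eventually.of_forall fun _ => zero_le) ?_
  filter_upwards [self_mem_nhdsWithin] with h (hh : 0 < h)
  have hm : Measurable fun ω => h⁻¹ * (Z ω * Real.exp (y h ω) - Z ω) -
      Z ω * (V (X t.toNNReal ω) - V (X 0 ω)) :=
    (((hZ.mul (hy h).exp).sub hZ).const_mul _).sub (hZ.mul ((hVs _).sub (hVs _)))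
  refine le_trans (le_of_eq ?_) (eLpNorm_integral_kernel_le μ P hm)
  congr 1
  funext x
  have e : ∀ ω, Z ω * Real.exp (y h ω) = Real.exp (pathIntegral X V h (h + t) ω) := fun ω => by
    simp only [Z, y]
    rw [← Real.exp_add]
    congr 1
    have a1 := hX.pathIntegral_add hV hK 0 t (t + h) ω
    have a2 := hX.pathIntegral_add hV hK 0 h (h + t) ω
    rw [add_comm h t] at a2 ⊢
    rw [zero_add]
    linarith
  have hstart : ∫ ω, Z ω * V (X 0 ω) ∂(P x) = V x * feynmanKac X P V t x := by
    have h2 : ∀ᵐ z ∂((P x).map (X 0)), V z = V x := by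
      rw [hX.start x]
      exact (ae_dirac_iff (measurableSet_eq_fun hV measurable_const)).2 rfl
    rw [feynmanKac, ← integral_const_mul]
    refine integral_congr_ae ?_
    filter_upwards [ae_of_ae_map (hX.measurable 0).aemeasurable h2] with ω hω
    rw [hω, mul_comm]
  have e2 : ∀ ω, h⁻¹ * (Z ω * Real.exp (y h ω) - Z ω) - Z ω * (V (X t.toNNReal ω) - V (X 0 ω)) =
      h⁻¹ * (Real.exp (pathIntegral X V h (h + t) ω) - Z ω) -
        (Z ω * V (X t.toNNReal ω) - Z ω * V (X 0 ω)) := fun ω => by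
    rw [e]
    ring
  have i1 := hX.integrable_exp_pathIntegral hV hK (show h ≤ h + t by linarith) (P x)
  have i2 : Integrable Z (P x) := hX.integrable_exp_pathIntegral hV hK ht (P x)
  have i3 : ∀ s, Integrable (fun ω => Z ω * V (X s ω)) (P x) := fun s =>
    hX.integrable_exp_mul hV hK ht s (P x)
  have i4 : Integrable (fun ω => Z ω * V (X t.toNNReal ω) - Z ω * V (X 0 ω)) (P x) :=
    (i3 _).sub (i3 0)
  refine Eq.trans ?_ (integral_congr_ae (ae_of_all _ e2)).symm
  rw [integral_const_mul_sub_sub h⁻¹ i1 i2 i4, integral_sub (i3 _) (i3 0), hstart,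
    hX.markovSemigroup_feynmanKac hV hK h.toNNReal ht x, Real.coe_toNNReal h hh.le]
  rfl

end Path

/-! ### The energy estimate for an abstract inner product. -/

section SharpForm

variable {H : Type*} [AddCommGroup H] [Module ℝ H] (ip : InnerProductSpace.Core ℝ H)

theorem core_inner_comm (g h : H) : ip.inner g h = ip.inner h g := by
  simpa using ip.conj_inner_symm g h |>.symm

theorem core_inner_add_left (g h k : H) : ip.inner (g + h) k = ip.inner g k + ip.inner h k :=
  ip.add_left g h k

theorem core_inner_smul_left (r : ℝ) (g h : H) : ip.inner (r • g) h = r * ip.inner g h := by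
  simpa using ip.smul_left g h r

theorem core_inner_add_right (g h k : H) : ip.inner g (h + k) = ip.inner g h + ip.inner g k := by
  rw [core_inner_comm, core_inner_add_left, core_inner_comm ip h, core_inner_comm ip k]

theorem core_inner_smul_right (r : ℝ) (g h : H) : ip.inner g (r • h) = r * ip.inner g h := by
  rw [core_inner_comm, core_inner_smul_left, core_inner_comm]

theorem core_inner_self_nonneg (g : H) : 0 ≤ ip.inner g g := by
  simpa using ip.re_inner_nonneg g

theorem sharpNorm_nonneg (g : H) : 0 ≤ sharpNorm ip g := Real.sqrt_nonneg _

theorem sharpNorm_sq (g : H) : sharpNorm ip g ^ 2 = ip.inner g g :=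
  Real.sq_sqrt (core_inner_self_nonneg ip g)

theorem abs_core_inner_le (g h : H) : |ip.inner g h| ≤ sharpNorm ip g * sharpNorm ip h := by
  have h1 := @InnerProductSpace.Core.inner_mul_inner_self_le ℝ H _ _ _ ip.toCore g h
  have h2 : |ip.inner g h| * |ip.inner h g| ≤ ip.inner g g * ip.inner h h := by simpa using h1
  rw [core_inner_comm ip h g, ← sharpNorm_sq, ← sharpNorm_sq, ← mul_pow, ← sq] at h2
  exact le_of_sq_le_sq h2 (mul_nonneg (sharpNorm_nonneg ip g) (sharpNorm_nonneg ip h))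

/-- The energy estimate `⟨(A + l M) u, u⟩_# ≤ l² v / (2 (1 - l b)) ‖u‖_#²` for `u = m 1 + h`,
`h` orthogonal to `1` and `a = A h = A u`. -/
theorem core_inner_energy_le {M Mdag : H → H} (hMadd : ∀ g h, M (g + h) = M g + M h)
    (hMsmul : ∀ (r : ℝ) g, M (r • g) = r • M g)
    (hadj : ∀ g h, ip.inner (M g) h = ip.inner g (Mdag h)) {one a h : H}
    (hone : ip.inner one one = 1) (hM1 : ip.inner (M one) one = 0) (ha : ip.inner a one = 0)
    (hh : ip.inner h one = 0) {α b l m : ℝ} (hα : 0 < α)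
    (hP : sharpNorm ip h ^ 2 ≤ α * ip.inner (-a) h)
    (hb : ∀ g, α * ip.inner (M g) g ≤ b * ip.inner g g) (hl : 0 ≤ l) (hlb : l * b < 1) :
    ip.inner (a + l • M (m • one + h)) (m • one + h) ≤
      bernsteinPsi (sharpV ip α M Mdag one) b l * ip.inner (m • one + h) (m • one + h) := by
  set w : H := (1 / 2 : ℝ) • (M one + Mdag one) with hw
  -- Through the adjoint, both cross terms `⟨M 1, h⟩` and `⟨M h, 1⟩` are carried by the single
  -- vector `w`.
  have hwh : ip.inner w h = 1 / 2 * (ip.inner (M one) h + ip.inner (M h) one) := by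
    rw [hw, core_inner_smul_left, core_inner_add_left, hadj h one, core_inner_comm ip h]
  have hself : ip.inner (m • one + h) (m • one + h) = m ^ 2 + sharpNorm ip h ^ 2 := by
    simp only [core_inner_add_left, core_inner_add_right, core_inner_smul_left,
      core_inner_smul_right, hone, hh, core_inner_comm ip one h, sharpNorm_sq]
    ring
  have hneg : ip.inner (-a) h = -ip.inner a h := by
    rw [← neg_one_smul ℝ a, core_inner_smul_left, neg_one_mul]
  have hexp : ip.inner (a + l • M (m • one + h)) (m • one + h) =
      ip.inner a h + l * (2 * m * ip.inner w h + ip.inner (M h) h) := by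
    rw [hMadd, hMsmul, hwh]
    simp only [core_inner_add_left, core_inner_add_right, core_inner_smul_left,
      core_inner_smul_right, hM1, ha]
    ring
  have hcs := abs_core_inner_le ip w h
  have hv : sharpV ip α M Mdag one = 2 * α * sharpNorm ip w ^ 2 := rfl
  have hbh := hb h
  rw [← sharpNorm_sq] at hbh
  rw [hself, hexp, hv, bernsteinPsi]
  set q := sharpNorm ip h
  set n := sharpNorm ip w
  have hq : 0 ≤ q := sharpNorm_nonneg ip h
  have hn : 0 ≤ n := sharpNorm_nonneg ip w
  have hd : 0 < 1 - l * b := by linarith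
  rw [hneg] at hP
  have h1 : m * ip.inner w h ≤ |m| * (n * q) := by
    refine (le_abs_self _).trans ?_
    rw [abs_mul]
    exact mul_le_mul_of_nonneg_left hcs (abs_nonneg m)
  have h2 : α * (ip.inner a h + l * (2 * m * ip.inner w h + ip.inner (M h) h)) ≤
      -((1 - l * b) * q ^ 2) + 2 * (l * α * |m| * n) * q := by
    have h3 := mul_le_mul_of_nonneg_left hbh hl
    have h4 := mul_le_mul_of_nonneg_left h1 (mul_nonneg hl hα.le)
    nlinarith
  -- Completing the square in `q = ‖h‖_#`; here `l b < 1` makes the quadratic concave.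
  have h5 : (-((1 - l * b) * q ^ 2) + 2 * (l * α * |m| * n) * q) * (1 - l * b) ≤
      (l * α * |m| * n) ^ 2 := by
    nlinarith [sq_nonneg ((1 - l * b) * q - l * α * |m| * n)]
  have h6 : (l * α * |m| * n) ^ 2 = α * (l ^ 2 * α * n ^ 2 * m ^ 2) := by
    rw [mul_pow, mul_pow, mul_pow, sq_abs]
    ring
  have h7 : (ip.inner a h + l * (2 * m * ip.inner w h + ip.inner (M h) h)) * (1 - l * b) ≤
      l ^ 2 * α * n ^ 2 * m ^ 2 := by
    have h8 := (mul_le_mul_of_nonneg_right h2 hd.le).trans (h5.trans_eq h6)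
    rw [mul_assoc] at h8
    exact le_of_mul_le_mul_left h8 hα
  rw [div_mul_eq_mul_div, le_div_iff₀ (by positivity)]
  have h9 : 0 ≤ l ^ 2 * α * n ^ 2 * q ^ 2 := by positivity
  nlinarith

end SharpForm

/-! ### Consequences of norm equivalence: the constant `b`, the adjoint, Gronwall. -/

section SharpHilbert

variable {H : Type*} [NormedAddCommGroup H] [InnerProductSpace ℝ H]
  (ip : InnerProductSpace.Core ℝ H) {c C : ℝ}

theorem mul_core_inner_le_sharpB (hc : 0 < c) (hcC : c ≤ C)
    (hnorm : ∀ g : H, c * ‖g‖ ≤ sharpNorm ip g ∧ sharpNorm ip g ≤ C * ‖g‖) {α : ℝ} (hα : 0 < α)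
    (M : H →L[ℝ] H) (g : H) : α * ip.inner (M g) g ≤ sharpB ip α M * ip.inner g g := by
  have hC : 0 < C := hc.trans_le hcC
  -- The real supremum in `sharpB` bounds the form only if the set is bounded above; norm
  -- equivalence and boundedness of `M` ensure this.
  have hbdd : BddAbove {a : ℝ | ∃ g : H, sharpNorm ip g = 1 ∧ a = ip.inner (M g) g} := by
    refine ⟨C * (‖M‖ * c⁻¹), ?_⟩
    rintro a ⟨g, hg, rfl⟩
    have h1 := (le_abs_self _).trans (abs_core_inner_le ip (M g) g)
    rw [hg, mul_one] at h1
    have h2 : ‖g‖ ≤ c⁻¹ := by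
      have := (hnorm g).1
      rw [hg] at this
      rw [inv_eq_one_div, le_div_iff₀ hc]
      linarith
    refine h1.trans ((hnorm (M g)).2.trans ?_)
    gcongr
    exact (M.le_opNorm g).trans (by gcongr)
  rcases eq_or_ne g 0 with rfl | hg
  · have h0 : ip.inner (0 : H) 0 = 0 := by
      simpa using core_inner_smul_left ip 0 (0 : H) 0
    simp [h0]
  have hpos : 0 < sharpNorm ip g := (mul_pos hc (norm_pos_iff.2 hg)).trans_le (hnorm g).1
  have hinv : 0 < (sharpNorm ip g)⁻¹ := inv_pos.2 hpos
  have hunit : sharpNorm ip ((sharpNorm ip g)⁻¹ • g) = 1 := by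
    have h1 : sharpNorm ip ((sharpNorm ip g)⁻¹ • g) ^ 2 = 1 := by
      rw [sharpNorm_sq, core_inner_smul_left, core_inner_smul_right, ← sharpNorm_sq]
      field_simp
    nlinarith [sharpNorm_nonneg ip ((sharpNorm ip g)⁻¹ • g)]
  have h2 := le_csSup hbdd ⟨_, hunit, rfl⟩
  rw [map_smul, core_inner_smul_left, core_inner_smul_right, ← mul_assoc, ← sq, inv_pow,
    inv_mul_le_iff₀ (by positivity), sharpNorm_sq] at h2
  rw [sharpB, mul_assoc]
  refine mul_le_mul_of_nonneg_left (h2.trans ?_) hα.le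
  rw [mul_comm]
  exact mul_le_mul_of_nonneg_right (le_max_right _ _) (core_inner_self_nonneg ip g)

theorem exists_core_inner_clm (hC : 0 ≤ C) (hnorm : ∀ g : H, sharpNorm ip g ≤ C * ‖g‖) :
    ∃ B : H →L[ℝ] H →L[ℝ] ℝ, ∀ g h, B g h = ip.inner g h := by
  let L : H →ₗ[ℝ] H →ₗ[ℝ] ℝ := LinearMap.mk₂ ℝ (fun g h => ip.inner g h)
    (core_inner_add_left ip) (core_inner_smul_left ip)
    (core_inner_add_right ip) (core_inner_smul_right ip)
  refine ⟨L.mkContinuous₂ (C * C) fun g h => ?_, fun g h => rfl⟩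
  refine (abs_core_inner_le ip g h).trans ?_
  refine (mul_le_mul (hnorm g) (hnorm h) (sharpNorm_nonneg ip h) (by positivity)).trans_eq ?_
  ring

/-- By Lax–Milgram the coercive form is `⟨g, h⟩_# = ⟨G g, h⟩` with `G` invertible, and the adjoint
is `G⁻¹ M* G`. -/
theorem exists_core_adjoint [CompleteSpace H] (hc : 0 < c) (hcC : c ≤ C)
    (hnorm : ∀ g : H, c * ‖g‖ ≤ sharpNorm ip g ∧ sharpNorm ip g ≤ C * ‖g‖) (M : H →L[ℝ] H) :
    ∃ Mdag : H →L[ℝ] H, ∀ g h, ip.inner (M g) h = ip.inner g (Mdag h) := by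
  obtain ⟨B, hB⟩ := exists_core_inner_clm ip (hc.le.trans hcC) fun g => (hnorm g).2
  have hcoer : IsCoercive B := by
    refine ⟨c ^ 2, by positivity, fun g => ?_⟩
    rw [hB, ← sharpNorm_sq, mul_assoc, ← sq, ← mul_pow]
    have := (hnorm g).1
    gcongr
  let G := hcoer.continuousLinearEquivOfBilin
  refine ⟨(G.symm : H →L[ℝ] H) ∘L (ContinuousLinearMap.adjoint M) ∘L (G : H →L[ℝ] H),
    fun g h => ?_⟩
  rw [core_inner_comm ip g, core_inner_comm ip (M g), ← hB, ← hB,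
    ← hcoer.continuousLinearEquivOfBilin_apply, ← hcoer.continuousLinearEquivOfBilin_apply]
  simp only [ContinuousLinearMap.comp_apply, ContinuousLinearEquiv.coe_coe]
  change _ = inner ℝ (G (G.symm _)) g
  rw [G.apply_symm_apply, ContinuousLinearMap.adjoint_inner_left]

/-- Gronwall's inequality for the quadratic form of `ip` along a right-differentiable curve. -/
theorem core_inner_le_exp_of_deriv_le (hC : 0 ≤ C)
    (hnorm : ∀ g : H, sharpNorm ip g ≤ C * ‖g‖) {U U' : ℝ → H} {κ T : ℝ} (hT : 0 ≤ T)
    (hcont : ContinuousOn U (Icc 0 T))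
    (hderiv : ∀ t ∈ Ico 0 T, HasDerivWithinAt U (U' t) (Ici t) t)
    (hle : ∀ t ∈ Ico 0 T, ip.inner (U' t) (U t) ≤ κ * ip.inner (U t) (U t)) :
    ip.inner (U T) (U T) ≤ ip.inner (U 0) (U 0) * Real.exp (2 * κ * T) := by
  obtain ⟨B, hB⟩ := exists_core_inner_clm ip hC hnorm
  have hφ : ContinuousOn (fun t => ip.inner (U t) (U t)) (Icc 0 T) := by
    simp_rw [← hB]
    exact (B.continuous.comp_continuousOn hcont).clm_apply hcont
  have hφ' : ∀ t ∈ Ico 0 T, HasDerivWithinAt (fun t => ip.inner (U t) (U t))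
      (2 * ip.inner (U' t) (U t)) (Ici t) t := fun t ht => by
    have h := B.hasDerivWithinAt_of_bilinear (hderiv t ht) (hderiv t ht)
    simp_rw [hB] at h
    rwa [core_inner_comm ip (U t) (U' t), ← two_mul] at h
  have h := le_gronwallBound_of_liminf_deriv_right_le (K := 2 * κ) (ε := 0) hφ
    (fun t ht r hr => (hφ' t ht).liminf_right_slope_le hr) le_rfl
    (fun t ht => by linarith [hle t ht]) T ⟨hT, le_rfl⟩
  rwa [gronwallBound_ε0, sub_zero] at h

end SharpHilbert

/-! ### From functions to curves and operators in `L²(μ)`. -/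

section Lp

variable {E : Type*} [MeasurableSpace E] {μ : Measure E}

theorem hasDerivWithinAt_toLp {u : ℝ → E → ℝ} (hu : ∀ t, MemLp (u t) 2 μ) {w : E → ℝ}
    (hw : MemLp w 2 μ) {t : ℝ}
    (h : Tendsto (fun s : ℝ => eLpNorm (fun x => s⁻¹ * (u (t + s) x - u t x) - w x) 2 μ)
      (𝓝[>] 0) (𝓝 0)) :
    HasDerivWithinAt (fun s => (hu s).toLp (u s)) (hw.toLp w) (Ici t) t := by
  rw [← hasDerivWithinAt_Ioi_iff_Ici, hasDerivWithinAt_iff_tendsto_slope' (by simp)]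
  have hm : ∀ s, MemLp ((s - t)⁻¹ • (u s - u t)) 2 μ := fun s => ((hu s).sub (hu t)).const_smul _
  have h1 := (Lp.tendsto_Lp_iff_tendsto_eLpNorm'' (fi := 𝓝[>] t) (p := 2)
    (fun s => (s - t)⁻¹ • (u s - u t)) hm w hw).2 ?_
  · refine h1.congr fun s => ?_
    rw [slope_def_module, MemLp.toLp_const_smul _ ((hu s).sub (hu t)),
      MemLp.toLp_sub (hu s) (hu t)]
  · have hs : Tendsto (fun s : ℝ => s - t) (𝓝[>] t) (𝓝[>] 0) := by
      refine tendsto_nhdsWithin_iff.2 ⟨?_, ?_⟩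
      · have hc : Continuous fun s : ℝ => s - t := by fun_prop
        simpa using (hc.tendsto t).mono_left nhdsWithin_le_nhds
      · filter_upwards [self_mem_nhdsWithin] with s (hs : t < s) using sub_pos.2 hs
    refine (h.comp hs).congr fun s => ?_
    simp only [Function.comp, add_sub_cancel]
    rfl

theorem continuousOn_toLp_of_lipschitz [IsProbabilityMeasure μ] {u : ℝ → E → ℝ}
    (hu : ∀ t, MemLp (u t) 2 μ) {S : Set ℝ} {L : ℝ} (hL : 0 ≤ L)
    (h : ∀ s ∈ S, ∀ t ∈ S, ∀ x, |u s x - u t x| ≤ L * |s - t|) :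
    ContinuousOn (fun s => (hu s).toLp (u s)) S := by
  refine LipschitzOnWith.continuousOn (K := ⟨L, hL⟩)
    (LipschitzOnWith.of_dist_le_mul fun s hs t ht => ?_)
  rw [dist_eq_norm, ← MemLp.toLp_sub]
  refine (Lp.norm_le_of_ae_bound (C := L * |s - t|) (by positivity) ?_).trans ?_
  · filter_upwards [((hu s).sub (hu t)).coeFn_toLp] with x hx
    rw [hx]
    exact h s hs t ht x
  · simp only [measureUnivNNReal, measure_univ, ENNReal.toNNReal_one, NNReal.coe_one,
      Real.one_rpow, one_mul, Real.dist_eq]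
    exact le_rfl

theorem mulOp_toLp {V : E → ℝ} (hV : MemLp V ∞ μ) {g : E → ℝ} (hg : MemLp g 2 μ) {k : E → ℝ}
    (hk : MemLp k 2 μ) (h : ∀ x, k x = V x * g x) : mulOp hV (hg.toLp g) = hk.toLp k := by
  refine Lp.ext ?_
  have h1 := (ContinuousLinearMap.mul ℝ ℝ).coeFn_holder (r := 2) (hV.toLp V) (hg.toLp g)
  filter_upwards [h1, hV.coeFn_toLp, hg.coeFn_toLp, hk.coeFn_toLp] with x e1 e2 e3 e4
  rw [e4, h, ← e2, ← e3]
  exact e1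

end Lp

/-! ### The Legendre transform and optimisation over `l`. -/

section Legendre

theorem bernsteinPsiStar_eq {v b r : ℝ} (hv : 0 < v) (hb : 0 ≤ b) (hr : 0 ≤ r) :
    bernsteinPsiStar v b r =
      ((2 * r ^ 2 / (v * (1 + √(1 + 2 * b * r / v)) ^ 2) : ℝ) : EReal) := by
  set s := √(1 + 2 * b * r / v) with hs
  have hs2 : s ^ 2 = 1 + 2 * b * r / v := Real.sq_sqrt (by positivity)
  have hs1 : 1 ≤ s := by
    rw [hs, Real.one_le_sqrt]
    exact le_add_of_nonneg_right (by positivity)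
  have hs0 : 0 < s := by linarith
  have hs2v : 2 * b * r = (s ^ 2 - 1) * v := by
    rw [hs2]
    field_simp
    ring
  -- With `b y = s - 1`, the gap between the claimed value and `l r - Ψ(l)` is a positive multiple
  -- of `(y (1 - l b) - l)²`, which vanishes at the maximiser `l = y / s`.
  set y := 2 * r / (v * (1 + s)) with hy
  have hyv : y * (v * (1 + s)) = 2 * r := by
    rw [hy]
    field_simp
  have hby : b * y = s - 1 := by
    have h1 : (b * y - (s - 1)) * (v * (1 + s)) = 0 := by
      linear_combination b * hyv + hs2v
    have h2 := (mul_eq_zero.1 h1).resolve_right (by positivity)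
    linarith
  have hval : 2 * r ^ 2 / (v * (1 + s) ^ 2) = v * y ^ 2 / 2 := by
    rw [hy]
    field_simp
  have hr2 : 2 * r = v * y * (2 + b * y) := by
    rw [hby]
    linarith
  rw [hval]
  refine le_antisymm (iSup₂_le fun l hl => ?_) ?_
  · have hq : 0 < 1 - l * b := by linarith [hl.2]
    rw [EReal.coe_le_coe_iff, bernsteinPsi, sub_le_iff_le_add, ← sub_le_iff_le_add',
      le_div_iff₀ (by positivity)]
    have h1 : 0 ≤ v * (y * (1 - l * b) - l) ^ 2 := by positivity
    have h2 : l * r = l * (v * y * (2 + b * y)) / 2 := by rw [← hr2]; ring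
    rw [h2]
    nlinarith
  · have hlb : y / s * b = (s - 1) / s := by
      rw [← hby]
      ring
    have hy0 : 0 ≤ y := by positivity
    refine le_iSup₂_of_le (y / s) ⟨by positivity, ?_⟩ (EReal.coe_le_coe_iff.2 (le_of_eq ?_))
    · rw [hlb, div_lt_one hs0]
      linarith
    · rw [bernsteinPsi, hlb]
      have h1 : 1 - (s - 1) / s = 1 / s := by
        field_simp
        ring
      have h2 : r = v * y * (1 + s) / 2 := by linarith
      rw [h1, h2]
      field_simp
      ring

/-- Taking logarithms turns the family of bounds into one on the supremum. The hypothesis `htop`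
covers the case `D = ∞` with infinite supremum, where the right-hand side is `∞ * 0 = 0`. -/
theorem le_mul_exp_neg_mul_iSup {k D : ℝ≥0∞} {T : ℝ} (hT : 0 < T) {S : Set ℝ} {y : ℝ → ℝ}
    (hS : S.Nonempty) (hk : k ≠ ∞) (h : ∀ l ∈ S, k * ENNReal.ofReal (Real.exp (T * y l)) ≤ D)
    (htop : D = ∞ → (⨆ l ∈ S, (y l : EReal)) = ⊤ → k = 0) :
    k ≤ D * EReal.exp (-((T : EReal) * ⨆ l ∈ S, (y l : EReal))) := by
  rcases eq_or_ne k 0 with rfl | hk0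
  · exact zero_le
  have hT' : (0 : EReal) < T := EReal.coe_pos.2 hT
  have h1 : (T : EReal) * ⨆ l ∈ S, (y l : EReal) ≤ ENNReal.log (D / k) := by
    rw [mul_comm, ← EReal.le_div_iff_mul_le hT' (EReal.coe_ne_top T)]
    refine iSup₂_le fun l hl => ?_
    rw [EReal.le_div_iff_mul_le hT' (EReal.coe_ne_top T), ← EReal.log_exp (y l * T),
      ENNReal.log_le_log_iff, ENNReal.le_div_iff_mul_le (Or.inl hk0) (Or.inl hk),
      mul_comm _ k, mul_comm (y l : EReal), ← EReal.coe_mul, EReal.exp_coe]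
    exact h l hl
  have h2 : EReal.exp ((T : EReal) * ⨆ l ∈ S, (y l : EReal)) ≤ D / k := by
    rw [← ENNReal.exp_log (D / k)]
    exact EReal.exp_monotone h1
  rw [ENNReal.le_div_iff_mul_le (Or.inl hk0) (Or.inl hk), mul_comm] at h2
  have hD0 : D ≠ 0 := by
    rintro rfl
    obtain ⟨l, hl⟩ := hS
    rcases mul_eq_zero.1 (le_zero_iff.1 (h l hl)) with h5 | h5
    · exact hk0 h5
    · exact (ENNReal.ofReal_pos.2 (Real.exp_pos _)).ne' h5
  rw [EReal.exp_neg, ← div_eq_mul_inv, ENNReal.le_div_iff_mul_le (Or.inr hD0)]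
  · exact h2
  by_contra! hE
  refine hk0 (htop hE.2 ?_)
  rcases (EReal.mul_eq_top _ _).1 (EReal.exp_eq_top_iff.1 hE.1) with h | h | h | h
  · exact absurd h.1 (EReal.coe_ne_bot T)
  · exact absurd h.1 hT'.le.not_gt
  · exact absurd h.1 (EReal.coe_ne_top T)
  · exact h.2

end Legendre

section Lp

variable {E : Type*} [MeasurableSpace E] {μ : Measure E} [IsProbabilityMeasure μ]

theorem inner_toLp_const_one {a : E → ℝ} (ha : MemLp a 2 μ) :
    inner ℝ (ha.toLp a) (Lp.const 2 μ (1 : ℝ)) = ∫ x, a x ∂μ := by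
  rw [L2.inner_def]
  refine integral_congr_ae ?_
  filter_upwards [ha.coeFn_toLp, Lp.coeFn_const (p := 2) (μ := μ) (1 : ℝ)] with x h1 h2
  rw [h1, h2]
  simp

end Lp

/-! ### The Feynman–Kac norm bound, Chernoff's inequality and the theorem. -/

section Main

variable {E Ω : Type*} [TopologicalSpace E] [TopologicalSpace.PseudoMetrizableSpace E]
  [MeasurableSpace E] [BorelSpace E] {mΩ : MeasurableSpace Ω}
  {ℱ : Filtration ℝ≥0 mΩ} {X : ℝ≥0 → Ω → E} {P : Kernel E Ω} {μ : Measure E}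
  [IsProbabilityMeasure μ]

theorem IsCadlagMarkovFamily.memLp_feynmanKac (hX : IsCadlagMarkovFamily ℱ X P) {V : E → ℝ}
    (hV : Measurable V) {K : ℝ} (hK : ∀ x, |V x| ≤ K) (t : ℝ) :
    MemLp (feynmanKac X P V t) 2 μ := by
  have := hX.isMarkovKernel
  refine MemLp.of_bound (hX.measurable_feynmanKac hV t).aestronglyMeasurable
    (Real.exp (K * |t - 0|)) (ae_of_all _ fun x => ?_)
  have h := norm_integral_le_of_norm_le_const (μ := P x) (C := Real.exp (K * |t - 0|))
    (f := fun ω => Real.exp (pathIntegral X V 0 t ω)) (ae_of_all _ fun ω => ?_)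
  · simpa [feynmanKac] using h
  · rw [Real.norm_eq_abs, Real.abs_exp, Real.exp_le_exp]
    have h1 := intervalIntegral.norm_integral_le_of_norm_le_const (a := 0) (b := t) (C := K)
      (f := fun s => V (X s.toNNReal ω)) fun s _ => hK _
    exact (le_abs_self _).trans h1

/-- The energy bound integrates to `‖u_T‖_#² ≤ exp(2 T Ψ_{v,b}(l))` for the Feynman–Kac function
`u_T` of the potential `l V`. -/
theorem IsInvariantLaw.core_inner_feynmanKac_le (hinv : IsInvariantLaw X P μ)
    (hX : IsCadlagMarkovFamily ℱ X P)
    (ip : InnerProductSpace.Core ℝ (Lp ℝ 2 μ)) {c C : ℝ} (hc : 0 < c) (hcC : c ≤ C)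
    (hnorm : ∀ g : Lp ℝ 2 μ, c * ‖g‖ ≤ sharpNorm ip g ∧ sharpNorm ip g ≤ C * ‖g‖)
    (hone : ∀ g : Lp ℝ 2 μ,
      ip.inner g (Lp.const 2 μ (1 : ℝ)) = inner ℝ g (Lp.const 2 μ (1 : ℝ)))
    {α : ℝ} (hα : 0 < α)
    (hpoincare : ∀ g Ag : Lp ℝ 2 μ, GeneratorGraph X P μ g Ag → ∫ x, g x ∂μ = 0 →
      sharpNorm ip g ^ 2 ≤ α * ip.inner (-Ag) g)
    {V : E → ℝ} (hV : Measurable V) {K : ℝ} (hK : ∀ x, |V x| ≤ K) (hVL : MemLp V ∞ μ)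
    (hV0 : ∫ x, V x ∂μ = 0) {Mdag : Lp ℝ 2 μ → Lp ℝ 2 μ}
    (hadj : ∀ g h : Lp ℝ 2 μ, ip.inner (mulOp hVL g) h = ip.inner g (Mdag h))
    {l : ℝ} (hl : 0 ≤ l) (hlb : l * sharpB ip α (mulOp hVL) < 1) {T : ℝ} (hT : 0 ≤ T)
    (hu : MemLp (feynmanKac X P (fun x => l * V x) T) 2 μ) :
    sharpNorm ip (hu.toLp _) ^ 2 ≤ Real.exp (2 *
      bernsteinPsi (sharpV ip α (mulOp hVL) Mdag (Lp.const 2 μ (1 : ℝ)))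
        (sharpB ip α (mulOp hVL)) l * T) := by
  have := hX.isMarkovKernel
  set W : E → ℝ := fun x => l * V x
  have hW : Measurable W := hV.const_mul l
  have hWK : ∀ x, |W x| ≤ l * K := fun x => by
    rw [abs_mul, abs_of_nonneg hl]
    exact mul_le_mul_of_nonneg_left (hK x) hl
  have hm : ∀ t, MemLp (feynmanKac X P W t) 2 μ := hX.memLp_feynmanKac hW hWK
  have hmd : ∀ t, 0 ≤ t → MemLp (feynmanKacDeriv X P W t) 2 μ := fun t ht =>
    MemLp.of_bound (hX.measurable_feynmanKacDeriv hW t).aestronglyMeasurable _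
      (ae_of_all _ fun x => hX.abs_feynmanKacDeriv_le hWK ht x)
  have hVm : MemLp V 2 μ := MemLp.of_bound hV.aestronglyMeasurable K (ae_of_all _ hK)
  have hone1 : ip.inner (Lp.const 2 μ (1 : ℝ)) (Lp.const 2 μ (1 : ℝ)) = 1 := by
    have h1 := inner_toLp_const_one (μ := μ) (memLp_const (1 : ℝ))
    rw [MemLp.toLp_const] at h1
    rw [hone, h1]
    simp
  have hM1 : ip.inner (mulOp hVL (Lp.const 2 μ (1 : ℝ))) (Lp.const 2 μ (1 : ℝ)) = 0 := by
    have h1 := mulOp_toLp hVL (memLp_const (1 : ℝ)) hVm (fun x => (mul_one _).symm)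
    rw [MemLp.toLp_const] at h1
    rw [hone, h1, inner_toLp_const_one, hV0]
  set κ := bernsteinPsi (sharpV ip α (mulOp hVL) Mdag (Lp.const 2 μ (1 : ℝ)))
        (sharpB ip α (mulOp hVL)) l
  let U : ℝ → Lp ℝ 2 μ := fun t => (hm t).toLp _
  -- The value for `t < 0` is irrelevant, as the derivative is used only on `[0, T)`.
  let U' : ℝ → Lp ℝ 2 μ := fun t => if ht : 0 ≤ t then (hmd t ht).toLp _ else 0
  have hcont : ContinuousOn U (Icc 0 T) := by
    refine continuousOn_toLp_of_lipschitz hm (L := Real.exp (l * K * T) * (l * K)) ?_ ?_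
    · obtain ⟨x⟩ : Nonempty E := nonempty_of_isProbabilityMeasure μ
      have := (abs_nonneg _).trans (hWK x)
      positivity
    · intro s hs t ht x
      rw [mul_assoc]
      exact hX.abs_feynmanKac_sub_le hW hWK hs ht x
  have hderiv : ∀ t ∈ Ico 0 T, HasDerivWithinAt U (U' t) (Ici t) t := fun t ht => by
    simp only [U', dif_pos ht.1]
    exact hasDerivWithinAt_toLp hm (hmd t ht.1) (hinv.tendsto_feynmanKac_slope hX hW hWK ht.1)
  have hle : ∀ t ∈ Ico 0 T, ip.inner (U' t) (U t) ≤ κ * ip.inner (U t) (U t) := fun t ht => by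
    simp only [U', dif_pos ht.1]
    set u := feynmanKac X P W t with hu
    have hum : Measurable u := hX.measurable_feynmanKac hW t
    have hub : ∀ x, |u x| ≤ Real.exp (l * K * t) := hX.abs_feynmanKac_le hWK ht.1
    set m := ∫ x, u x ∂μ
    let a : E → ℝ := fun x => feynmanKacDeriv X P W t x - W x * u x
    have hWu : MemLp (fun x => W x * u x) 2 μ :=
      MemLp.of_bound (hW.mul hum).aestronglyMeasurable (l * K * Real.exp (l * K * t))
        (ae_of_all _ fun x => by
          rw [Real.norm_eq_abs, abs_mul]
          exact mul_le_mul (hWK x) (hub x) (abs_nonneg _) ((abs_nonneg _).trans (hWK x)))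
    have hVu : MemLp (fun x => V x * u x) 2 μ :=
      MemLp.of_bound (hV.mul hum).aestronglyMeasurable (K * Real.exp (l * K * t))
        (ae_of_all _ fun x => by
          rw [Real.norm_eq_abs, abs_mul]
          exact mul_le_mul (hK x) (hub x) (abs_nonneg _) ((abs_nonneg _).trans (hK x)))
    have ha : MemLp a 2 μ := (hmd t ht.1).sub hWu
    have hmc : MemLp (fun _ : E => m) 2 μ := memLp_const m
    have hh : MemLp (fun x => u x - m) 2 μ := (hm t).sub hmc
    have hlim := hinv.tendsto_markovSemigroup_feynmanKac hX hW hWK ht.1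
    have ha0 : ∫ x, a x ∂μ = 0 :=
      hinv.integral_eq_zero_of_tendsto hX hum hub ha hlim
    have hh0 : ∫ x, (u x - m) ∂μ = 0 := by
      have hui : Integrable u μ := (hm t).integrable (by norm_num)
      rw [integral_sub hui (integrable_const m)]
      simp [m]
    -- Constants are fixed by the semigroup, so `h = u - m` has the same difference quotients as
    -- `u`, hence the same image under the generator.
    have hgen : GeneratorGraph X P μ (hh.toLp _) (ha.toLp a) := by
      refine hinv.generatorGraph_toLp hX hh ha (hlim.congr fun s => ?_)
      congr 1
      funext x
      have hi : Integrable (fun ω => u (X s.toNNReal ω)) (P x) :=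
        Integrable.of_bound (hum.comp (hX.measurable _)).aestronglyMeasurable _
          (ae_of_all _ fun ω => hub _)
      have e : markovSemigroup X P s.toNNReal (fun x => u x - m) x =
          markovSemigroup X P s.toNNReal u x - m := by
        simp only [markovSemigroup]
        rw [integral_sub hi (integrable_const m)]
        simp
      rw [e]
      ring
    have hP := hpoincare _ _ hgen (by rw [integral_congr_ae hh.coeFn_toLp, hh0])
    have hsum : (hm t).toLp u = m • Lp.const 2 μ (1 : ℝ) + hh.toLp _ := by
      have h1 : m • Lp.const 2 μ (1 : ℝ) = hmc.toLp _ := by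
        rw [← MemLp.toLp_const, ← MemLp.toLp_const_smul]
        congr 1
        funext x
        simp
      rw [h1, ← MemLp.toLp_add]
      congr 1
      funext x
      simp
    have hd : (hmd t ht.1).toLp _ = ha.toLp a + l • mulOp hVL ((hm t).toLp u) := by
      rw [mulOp_toLp hVL (hm t) hVu (fun _ => rfl), ← MemLp.toLp_const_smul, ← MemLp.toLp_add]
      congr 1
      funext x
      simp [a, W, mul_assoc]
    have key := core_inner_energy_le ip (M := mulOp hVL) (Mdag := Mdag) (map_add _)
      (fun r g => map_smul _ r g) hadj (one := Lp.const 2 μ (1 : ℝ)) (a := ha.toLp a)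
      (h := hh.toLp _) (m := m) hone1 hM1 (by rw [hone, inner_toLp_const_one, ha0])
      (by rw [hone, inner_toLp_const_one, hh0]) hα hP
      (mul_core_inner_le_sharpB ip hc hcC hnorm hα (mulOp hVL)) hl hlb
    rw [← hsum, ← hd] at key
    exact key
  have hU0 : U 0 = Lp.const 2 μ (1 : ℝ) := by
    rw [← MemLp.toLp_const]
    simp only [U]
    congr 1
    funext x
    simp [feynmanKac, pathIntegral]
  have h := core_inner_le_exp_of_deriv_le ip (hc.le.trans hcC) (fun g => (hnorm g).2) hT hcont
    hderiv hle
  rw [hU0, hone1, one_mul] at h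
  rw [sharpNorm_sq]
  exact h

/-- The factor `c⁻¹` arises only here, on returning to the `L²` norm; the initial value `u_0 = 1`
has `‖1‖_# = 1` exactly. -/
theorem IsInvariantLaw.eLpNorm_feynmanKac_le (hinv : IsInvariantLaw X P μ)
    (hX : IsCadlagMarkovFamily ℱ X P)
    (ip : InnerProductSpace.Core ℝ (Lp ℝ 2 μ)) {c C : ℝ} (hc : 0 < c) (hcC : c ≤ C)
    (hnorm : ∀ g : Lp ℝ 2 μ, c * ‖g‖ ≤ sharpNorm ip g ∧ sharpNorm ip g ≤ C * ‖g‖)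
    (hone : ∀ g : Lp ℝ 2 μ,
      ip.inner g (Lp.const 2 μ (1 : ℝ)) = inner ℝ g (Lp.const 2 μ (1 : ℝ)))
    {α : ℝ} (hα : 0 < α)
    (hpoincare : ∀ g Ag : Lp ℝ 2 μ, GeneratorGraph X P μ g Ag → ∫ x, g x ∂μ = 0 →
      sharpNorm ip g ^ 2 ≤ α * ip.inner (-Ag) g)
    {V : E → ℝ} (hV : Measurable V) {K : ℝ} (hK : ∀ x, |V x| ≤ K) (hVL : MemLp V ∞ μ)
    (hV0 : ∫ x, V x ∂μ = 0) {Mdag : Lp ℝ 2 μ → Lp ℝ 2 μ}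
    (hadj : ∀ g h : Lp ℝ 2 μ, ip.inner (mulOp hVL g) h = ip.inner g (Mdag h))
    {l : ℝ} (hl : 0 ≤ l) (hlb : l * sharpB ip α (mulOp hVL) < 1) {T : ℝ} (hT : 0 ≤ T) :
    eLpNorm (feynmanKac X P (fun x => l * V x) T) 2 μ ≤
      (ENNReal.ofReal c)⁻¹ * ENNReal.ofReal (Real.exp (T *
        bernsteinPsi (sharpV ip α (mulOp hVL) Mdag (Lp.const 2 μ (1 : ℝ)))
          (sharpB ip α (mulOp hVL)) l)) := by
  have hu : MemLp (feynmanKac X P (fun x => l * V x) T) 2 μ := by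
    refine hX.memLp_feynmanKac (hV.const_mul l) (K := l * K) (fun x => ?_) T
    rw [abs_mul, abs_of_nonneg hl]
    exact mul_le_mul_of_nonneg_left (hK x) hl
  have h1 := hinv.core_inner_feynmanKac_le hX ip hc hcC hnorm hone hα hpoincare hV hK hVL hV0
    hadj hl hlb hT hu
  set κ := bernsteinPsi (sharpV ip α (mulOp hVL) Mdag (Lp.const 2 μ (1 : ℝ)))
          (sharpB ip α (mulOp hVL)) l
  have h2 : sharpNorm ip (hu.toLp _) ≤ Real.exp (T * κ) := by
    refine le_of_sq_le_sq (h1.trans_eq ?_) (Real.exp_pos _).le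
    rw [← Real.exp_nat_mul]
    congr 1
    push_cast
    ring
  have h3 := (hnorm (hu.toLp _)).1.trans h2
  rw [Lp.norm_toLp] at h3
  rw [mul_comm, ← div_eq_mul_inv, ENNReal.le_div_iff_mul_le
    (Or.inl (ENNReal.ofReal_pos.2 hc).ne') (Or.inl ENNReal.ofReal_ne_top),
    ← ENNReal.ofReal_toReal hu.eLpNorm_ne_top, mul_comm, ← ENNReal.ofReal_mul hc.le]
  exact ENNReal.ofReal_le_ofReal h3

/-- Chernoff's bound together with the Cauchy–Schwarz inequality in `L²(μ)`. -/
theorem IsCadlagMarkovFamily.measure_le_pathIntegral_mul_le (hX : IsCadlagMarkovFamily ℱ X P)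
    {V : E → ℝ} (hV : Measurable V) {K : ℝ} (hK : ∀ x, |V x| ≤ K) {T : ℝ} (hT : 0 ≤ T)
    (ν : Measure E) [IsProbabilityMeasure ν] (hν : ν ≪ μ) (s : ℝ) :
    (ν.bind P) {ω | s ≤ pathIntegral X V 0 T ω} * ENNReal.ofReal (Real.exp s) ≤
      eLpNorm (ν.rnDeriv μ) 2 μ * eLpNorm (feynmanKac X P V T) 2 μ := by
  have := hX.isMarkovKernel
  have hZ : Measurable fun ω => ENNReal.ofReal (Real.exp (pathIntegral X V 0 T ω)) :=
    (hX.measurable_pathIntegral hV 0 T).exp.ennreal_ofReal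
  have hum := hX.measurable_feynmanKac (P := P) hV T
  have hu0 : ∀ x, 0 ≤ feynmanKac X P V T x := fun x => integral_nonneg fun ω => (Real.exp_pos _).le
  calc (ν.bind P) {ω | s ≤ pathIntegral X V 0 T ω} * ENNReal.ofReal (Real.exp s)
      ≤ ENNReal.ofReal (Real.exp s) * (ν.bind P)
          {ω | ENNReal.ofReal (Real.exp s) ≤
            ENNReal.ofReal (Real.exp (pathIntegral X V 0 T ω))} := by
        rw [mul_comm]
        gcongr with ω
        exact fun h => ENNReal.ofReal_le_ofReal (Real.exp_le_exp.2 h)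
    _ ≤ ∫⁻ ω, ENNReal.ofReal (Real.exp (pathIntegral X V 0 T ω)) ∂(ν.bind P) :=
        mul_meas_ge_le_lintegral₀ hZ.aemeasurable _
    _ = ∫⁻ x, ‖feynmanKac X P V T x‖ₑ ∂ν := by
        rw [Measure.lintegral_bind P.aemeasurable hZ.aemeasurable]
        refine lintegral_congr fun x => ?_
        rw [Real.enorm_of_nonneg (hu0 x), feynmanKac, ofReal_integral_eq_lintegral_ofReal
          (hX.integrable_exp_pathIntegral hV hK hT _) (ae_of_all _ fun ω => (Real.exp_pos _).le)]
    _ = ∫⁻ x, ν.rnDeriv μ x * ‖feynmanKac X P V T x‖ₑ ∂μ :=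
        (lintegral_rnDeriv_mul hν hum.enorm.aemeasurable).symm
    _ ≤ _ := by
        refine (ENNReal.lintegral_mul_le_Lp_mul_Lq μ (p := 2) (q := 2)
          (Real.HolderConjugate.two_two) (ν.measurable_rnDeriv μ).aemeasurable
          hum.enorm.aemeasurable).trans (le_of_eq ?_)
        rw [eLpNorm_eq_lintegral_rpow_enorm_toReal two_ne_zero ENNReal.ofNat_ne_top,
          eLpNorm_eq_lintegral_rpow_enorm_toReal two_ne_zero ENNReal.ofNat_ne_top]
        simp

end Main

theorem theorem3p1 {E Ω : Type*} [TopologicalSpace E] [PolishSpace E] [MeasurableSpace E]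
    [BorelSpace E] {mΩ : MeasurableSpace Ω} (ℱ : Filtration ℝ≥0 mΩ) (X : ℝ≥0 → Ω → E)
    (P : Kernel E Ω) (hX : IsCadlagMarkovFamily ℱ X P)
    (μs : Measure E) [IsProbabilityMeasure μs] (hinv : IsInvariantLaw X P μs)
    (herg : IsErgodicLaw X P μs)
    (ip : InnerProductSpace.Core ℝ (Lp ℝ 2 μs)) (c C : ℝ) (hc : 0 < c) (hcC : c ≤ C)
    (hnorm : ∀ g : Lp ℝ 2 μs, c * ‖g‖ ≤ sharpNorm ip g ∧ sharpNorm ip g ≤ C * ‖g‖)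
    (hone : ∀ g : Lp ℝ 2 μs,
      ip.inner g (Lp.const 2 μs (1 : ℝ)) = inner ℝ g (Lp.const 2 μs (1 : ℝ)))
    (α : ℝ) (hα : 0 < α)
    (hpoincare : ∀ g Ag : Lp ℝ 2 μs, GeneratorGraph X P μs g Ag → ∫ x, g x ∂μs = 0 →
      sharpNorm ip g ^ 2 ≤ α * ip.inner (-Ag) g)
    (f : E → ℝ) (hf : Measurable f) (hbdd : ∃ K, ∀ x, |f x| ≤ K)
    (σ : ℝ) (hσ : σ = 1 ∨ σ = -1) :
    -- `Mdag` is the adjoint of `M_{± (f - μs[f])}` for the inner product `ip`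
    ∃ Mdag : Lp ℝ 2 μs →L[ℝ] Lp ℝ 2 μs,
      (∀ g h : Lp ℝ 2 μs,
        ip.inner (mulOp (memLp_centered μs hf hbdd σ) g) h = ip.inner g (Mdag h)) ∧
      ∀ v b : ℝ,
        v = sharpV ip α (mulOp (memLp_centered μs hf hbdd σ)) Mdag (Lp.const 2 μs (1 : ℝ)) →
        b = sharpB ip α (mulOp (memLp_centered μs hf hbdd σ)) →
        ∀ r : ℝ, 0 ≤ r →
          (∀ (T : ℝ), 0 < T → ∀ (μ : Measure E), IsProbabilityMeasure μ → μ ≪ μs →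
            (μ.bind P) {ω | r ≤
                σ * (1 / T * (∫ t in (0 : ℝ)..T, f (X t.toNNReal ω)) - ∫ x, f x ∂μs)} ≤
              (ENNReal.ofReal c)⁻¹ * eLpNorm (μ.rnDeriv μs) 2 μs *
                EReal.exp (-((T : EReal) * bernsteinPsiStar v b r))) ∧
          (0 < v → bernsteinPsiStar v b r =
            ((2 * r ^ 2 / (v * (1 + √(1 + 2 * b * r / v)) ^ 2) : ℝ) : EReal)) := by
  have := hX.isMarkovKernel
  obtain ⟨K, hK⟩ := hbdd
  set m := ∫ x, f x ∂μs with hm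
  let V : E → ℝ := fun x => σ * (f x - m)
  have hV : Measurable V := (hf.sub_const m).const_mul σ
  have hσ1 : |σ| = 1 := by rcases hσ with rfl | rfl <;> simp
  have hVK : ∀ x, |V x| ≤ K + |m| := fun x => by
    rw [abs_mul, hσ1, one_mul]
    exact (abs_sub _ _).trans (by linarith [hK x])
  have hV0 : ∫ x, V x ∂μs = 0 := by
    have hfi : Integrable f μs := Integrable.of_bound hf.aestronglyMeasurable K (ae_of_all _ hK)
    rw [integral_const_mul, integral_sub hfi (integrable_const m)]
    simp [m]
  have hVL : MemLp V ∞ μs := memLp_centered μs hf ⟨K, hK⟩ σ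
  obtain ⟨Mdag, hadj⟩ := exists_core_adjoint ip hc hcC hnorm (mulOp hVL)
  refine ⟨Mdag, hadj, ?_⟩
  rintro v b hv hb r hr
  have hb0 : 0 ≤ b := by
    rw [hb]
    exact mul_nonneg hα.le (le_max_left _ _)
  refine ⟨fun T hT μ hμ hμs => ?_, fun hvpos => bernsteinPsiStar_eq hvpos hb0 hr⟩
  set A : Set Ω := {ω | r ≤ σ * (1 / T * (∫ t in (0 : ℝ)..T, f (X t.toNNReal ω)) - m)} with hA
  have hsub : ∀ l : ℝ, 0 ≤ l →
      A ⊆ {ω | T * (l * r) ≤ pathIntegral X (fun x => l * V x) 0 T ω} := fun l hl ω hω => by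
    have e : pathIntegral X (fun x => l * V x) 0 T ω =
        T * (l * (σ * (1 / T * (∫ t in (0 : ℝ)..T, f (X t.toNNReal ω)) - m))) := by
      simp only [pathIntegral, V]
      rw [intervalIntegral.integral_const_mul, intervalIntegral.integral_const_mul,
        intervalIntegral.integral_sub (hX.intervalIntegrable_path hf hK ω 0 T)
          intervalIntegrable_const, intervalIntegral.integral_const]
      field_simp
      simp
    rw [mem_ofPred_eq, e]
    exact mul_le_mul_of_nonneg_left (mul_le_mul_of_nonneg_left hω hl) hT.le
  -- The initial law is kept general because the bound is also needed for `μs` itself.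
  have hbound : ∀ ν : Measure E, IsProbabilityMeasure ν → ν ≪ μs →
      ∀ l ∈ {l : ℝ | 0 ≤ l ∧ l * b < 1}, (ν.bind P) A *
        ENNReal.ofReal (Real.exp (T * (l * r - bernsteinPsi v b l))) ≤
          (ENNReal.ofReal c)⁻¹ * eLpNorm (ν.rnDeriv μs) 2 μs := by
    rintro ν hν hνs l ⟨hl, hlb⟩
    have hlV : Measurable fun x => l * V x := hV.const_mul l
    have hlK : ∀ x, |l * V x| ≤ l * (K + |m|) := fun x => by
      rw [abs_mul, abs_of_nonneg hl]
      exact mul_le_mul_of_nonneg_left (hVK x) hl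
    have h1 := hX.measure_le_pathIntegral_mul_le hlV hlK hT.le ν hνs (T * (l * r))
    have h2 := hinv.eLpNorm_feynmanKac_le hX ip hc hcC hnorm hone hα hpoincare hV hVK hVL hV0
      hadj hl (by rw [hb] at hlb; exact hlb) hT.le
    have h3 : eLpNorm (feynmanKac X P (fun x => l * V x) T) 2 μs ≤
        (ENNReal.ofReal c)⁻¹ * ENNReal.ofReal (Real.exp (T * bernsteinPsi v b l)) := by
      rw [hv, hb]
      exact h2
    have h4 : (ν.bind P) A * ENNReal.ofReal (Real.exp (T * (l * r))) ≤
        eLpNorm (ν.rnDeriv μs) 2 μs *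
          ((ENNReal.ofReal c)⁻¹ * ENNReal.ofReal (Real.exp (T * bernsteinPsi v b l))) :=
      (mul_le_mul_left (measure_mono (hsub l hl)) _).trans
        (h1.trans (mul_le_mul_right h3 _))
    have h5 : ENNReal.ofReal (Real.exp (T * (l * r - bernsteinPsi v b l))) =
        ENNReal.ofReal (Real.exp (T * (l * r))) *
          ENNReal.ofReal (Real.exp (-(T * bernsteinPsi v b l))) := by
      rw [← ENNReal.ofReal_mul (Real.exp_pos _).le, ← Real.exp_add]
      ring_nf
    have h6 : ENNReal.ofReal (Real.exp (T * bernsteinPsi v b l)) *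
        ENNReal.ofReal (Real.exp (-(T * bernsteinPsi v b l))) = 1 := by
      rw [← ENNReal.ofReal_mul (Real.exp_pos _).le, ← Real.exp_add]
      simp
    rw [h5, ← mul_assoc]
    refine (mul_le_mul_left h4 _).trans (le_of_eq ?_)
    rw [mul_assoc, mul_assoc, h6, mul_one, mul_comm]
  have h0 : (0 : ℝ) ∈ {l : ℝ | 0 ≤ l ∧ l * b < 1} := ⟨le_rfl, by simp⟩
  refine le_mul_exp_neg_mul_iSup hT ⟨0, h0⟩ (measure_ne_top _ _) (hbound μ hμ hμs) ?_
  -- When the supremum is infinite, the bound started from `μs`, whose density is `1`, shows that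
  -- `A` is null under `P^{μs}`. Since `μ ≪ μs`, it is then null under `P^μ`, as the convention `∞ *
  -- 0 = 0` demands.
  intro _ htop
  have hself := le_mul_exp_neg_mul_iSup hT ⟨0, h0⟩ (measure_ne_top _ _)
    (hbound μs inferInstance Measure.AbsolutelyContinuous.rfl) ?_
  · rw [htop, EReal.coe_mul_top_of_pos hT, EReal.neg_top, EReal.exp_bot, mul_zero] at hself
    exact (hμs.comp_right P) (le_zero_iff.1 hself)
  · intro hinf
    refine absurd hinf (ENNReal.mul_ne_top (ENNReal.inv_ne_top.2 (ENNReal.ofReal_pos.2 hc).ne') ?_)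
    rw [eLpNorm_congr_ae μs.rnDeriv_self]
    rw [eLpNorm_const _ two_ne_zero (IsProbabilityMeasure.ne_zero μs)]
    simp
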